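/- **Conventions.** A *class of display maps* in a category $\mathbb C$ is a class $\mathcal D$ of morphisms that contains the identities, and such that every $f\in\mathcal D$ has a pullback along every map into its codomain, every such pullback being again in $\mathcal D$; $(\mathbb C,\mathcal D)$ is then a *display map category*. It is *well-rooted* if $\mathbb C$ has a terminal object $1$ and every $X\to 1$ is in $\mathcal D$. It has *$\Sigma$-types* if $\mathcal D$ is closed under composition, and *$\Pi$-types* if for all $f:B\to A$ and $g:C\to B$ in $\mathcal D$ there is an $f^*$-couniversal arrow with codomain $g$ whose domain is in $\mathcal D$, where $f^*:\mathbb C/A\to\mathbb C/B$ is pullback. Let $\mathcal D/I$ be the full subcategory of $\mathbb C/I$ on the members of $\mathcal D$, let $\mathcal D_I$ be the class of its maps with underlying arrow in $\mathcal D$, and let ${}^\square\mathcal F$ be the class of maps with the left lifting property against $\mathcal F$. $(\mathbb C,\mathcal D)$ has *identity types* if pullback $h^*:\mathcal D/J\to\mathcal D/I$ maps ${}^\square\mathcal D_J$ into ${}^\square\mathcal D_I$ for every $h:I\to J$, and every map of $\mathcal D/I$ factors as a map in ${}^\square\mathcal D_I$ followed by one in $\mathcal D_I$. A subclass $\mathcal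 D'\subseteq\mathcal D$ is *closed under identity types* if every map of $\mathcal D'/I$ factors in $\mathcal D'/I$ as a map in ${}^\square\mathcal D_I$ followed by a map whose underlying arrow is in $\mathcal D'$. A *universe* in $(\mathbb C,\mathcal D)$ is a $u\in\mathcal D$ such that the class $\mathcal D_u$ of pullbacks of $u$ (the *$u$-small* maps) is a class of display maps; it is *closed under $\Sigma$-, $\Pi$-types* if $(\mathbb C,\mathcal D_u)$ has $\Sigma$-, $\Pi$-types, and *closed under identity types* if $\mathcal D_u\subseteq\mathcal D$ is. A *fibred display map category* is a fibration $p:\mathbb E\to\mathbb B$ with a class of display maps $\mathcal E_I$ in each fibre $\mathbb E(I)$, such that reindexing preserves these maps and all pullbacks of them. If $(\mathbb B,\mathcal D)$ is a display map category, the *glued* category is $(\mathbb E,\mathcal G)$, where $\mathcal G$ consists of the maps of $\mathbb E$ lying over a map in $\mathcal D$ and having vertical component in some $\mathcal E_I$. A *quasifibred universe* is an object $\Omega\in\mathbb B$ and an $\mathcal E_\Omega$-map $v$ such that all vertical isomorphisms are *$v$-small*, where a map of $\mathbb E(I)$ is $v$-small if it is a pullback in $\mathbb E(I)$ of $f^*(v)$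 for some $f:I\to\Omega$. We say that $p$ *has $\mathcal D$-products* if $f^*$ has a right adjoint $\prod_f$ for every $f\in\mathcal D$ and these satisfy the Beck–Chevalley condition. A *quasifibred product* of an $\mathcal E_I$-map $\psi:Z\to Y$ along an $\mathcal E_I$-map $\phi:Y\to X$ consists of a $\mathcal D$-map $q:Q\to I$, an $\mathcal E_Q$-map $\pi:P\to q^*X$ and, for every $w:W\to X$ in $\mathbb E(I)$, a bijection, natural in $W$, between the maps $\phi^*(w)\to\psi$ in $\mathbb E(I)/Y$ and the pairs $(s,t)$ of a section $s$ of $q$ and a map $t:w\to s^*(\pi)$ in $\mathbb E(I)/X$. All of this is required to be stable under reindexing: for each $h:I'\to I$ the reindexed maps $h^*q$ and $\pi$ carry such bijections for $h^*\psi$ and $h^*\phi$, compatibly with further reindexing. **Theorem.** Let $(\mathbb B,\mathcal D)$ be a well-rooted display map category with $\Pi$-types, and let $(p:\mathbb E\to\mathbb B,\mathcal E)$ be a fibred display map category such that $p$ has $\mathcal D$-products. Let $u:\widetilde{\mathcal U}\to\mathcal U$ be a universe in $(\mathbb B,\mathcal D)$ and $(\Omega,v:\widetilde{\mathcal V}\to\mathcal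 V)$ a quasifibred universe in $(p,\mathcal E)$. 1. There is a universe $w:\widetilde{\mathcal W}\to\mathcal W$ in $(\mathbb E,\mathcal G)$ whose small maps are precisely those $\mathcal G$-maps that lie over a $u$-small map and whose vertical component is $v$-small. 2. Suppose moreover that: - $(\mathbb B,\mathcal D)$ has $\Sigma$-types and identity types; - each $(\mathbb E(I),\mathcal E_I)$ is well-rooted and has $\Sigma$-types and identity types, and reindexing along $h:I\to J$ maps ${}^\square\mathcal E_J$ into ${}^\square\mathcal E_I$; - (left map condition) for every $m:I\to J$ in ${}^\square\mathcal D$ and $X\in\mathbb E(J)$ the functor $\mathcal E_J/X\to\mathcal E_I/m^*X$ induced by $m^*$ is full; - the $\mathcal D$-products of $p$ preserve the classes $\mathcal E_I$; - $u$ is closed under $\Sigma$-, $\Pi$- and identity types; - for each $I\in\mathbb B$ the $v$-small maps of $\mathbb E(I)$ are closed under composition and, as a subclass of $\mathcal E_I$, under identity types, and the $v$-small maps are closed under the products $\prod_f$ along $u$-small maps $f$; - all $\mathcal E_I$-maps $\psi:Z\to Y$ and $\phi:Y\to X$ in a common fibre have a quasifibred product $(q,\pi)$, which can be chosen so that $q$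 is $u$-small and $\pi$ is $v$-small whenever $\phi$ and $\psi$ are $v$-small. Then every universe $w$ as in 1 is closed under $\Sigma$-, $\Pi$- and identity types. -/

import Mathlib

open CategoryTheory CategoryTheory.Limits

universe v₁ v₂ u₁ u₂

namespace Gluing

open CategoryTheory.Functor CategoryTheory.Functor.Fiber

/-! ### Display map categories -/

section DisplayMaps

variable {C : Type u₁} [Category.{v₁} C]

/-- `D` is a class of display maps in `C`: it contains the identities, pullbacks of members of `D`
along arbitrary maps exist, and every such pullback is again in `D`. -/
class IsDisplayMapClass (D : MorphismProperty C) : Prop extends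
  D.ContainsIdentities, D.HasPullbacks, D.IsStableUnderBaseChange

/-- There is a terminal object `1`, and every `X ⟶ 1` is a display map. -/
def WellRooted (D : MorphismProperty C) : Prop :=
  ∃ (T : C) (hT : IsTerminal T), ∀ X : C, D (hT.from X)

/-- `Σ`-types: display maps are closed under composition. -/
def HasSigmaTypes (D : MorphismProperty C) : Prop :=
  D.IsStableUnderComposition

/-- `Π`-types: for display maps `f : B ⟶ A` and `g : C ⟶ B` there is an `f^*`-couniversal arrow
with codomain `g` (a terminal object of the comma category `f^* ↓ g`, where
`f^* : Over A ⥤ Over B` is the pullback functor) whose domain is a display map. -/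
def HasPiTypes (D : MorphismProperty C) : Prop :=
  ∀ ⦃B A X : C⦄ (f : B ⟶ A) (g : X ⟶ B), D f → D g →
    ∃ (_ : HasPullbacksAlong f) (T : CostructuredArrow (Over.pullback f) (Over.mk g)),
      D T.left.hom ∧ Nonempty (IsTerminal T)

/-- The display slice category `D / I`: the full subcategory of `Over I` on the members of `D`. -/
abbrev DisplaySlice (D : MorphismProperty C) (I : C) :=
  ObjectProperty.FullSubcategory (fun f : Over I => D f.hom)

/-- The class of those morphisms of `D / I` whose underlying arrow is in `D'`. For `D' = D` this
is the class `D_I` of display maps of `D / I`. -/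
def sliceClass (D D' : MorphismProperty C) (I : C) : MorphismProperty (DisplaySlice D I) :=
  fun _ _ f => D' f.hom.left

/-- The left class of `D_I` in `D / I`. -/
abbrev leftClass (D : MorphismProperty C) (I : C) : MorphismProperty (DisplaySlice D I) :=
  (sliceClass D D I).llp

/-- Stable left classes: if `A'`, `B'` are pullbacks of `A`, `B` in `D / J` along `h : I ⟶ J` and
`m' : A' ⟶ B'` is the map induced by a left map `m : A ⟶ B`, then `m'` is a left map. -/
def HasStableLeftClasses (D : MorphismProperty C) : Prop :=
  ∀ ⦃I J : C⦄ (h : I ⟶ J) ⦃A B : DisplaySlice D J⦄ ⦃A' B' : DisplaySlice D I⦄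
    (m : A ⟶ B) (m' : A' ⟶ B') (α : A'.obj.left ⟶ A.obj.left) (β : B'.obj.left ⟶ B.obj.left),
    IsPullback α A'.obj.hom A.obj.hom h → IsPullback β B'.obj.hom B.obj.hom h →
    α ≫ m.hom.left = m'.hom.left ≫ β →
    leftClass D J m → leftClass D I m'

/-- Identity types: stable left classes, and every map of every `D / I` factors as a left map
followed by a display map. -/
def HasIdentityTypes (D : MorphismProperty C) : Prop :=
  HasStableLeftClasses D ∧
    ∀ I : C, (leftClass D I).HasFactorization (sliceClass D D I)

/-- A subclass `D'` of `D` is closed under identity types of `D`: every map of `D' / I` factors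
within `D' / I` as a left map with respect to `D_I` in `D / I` followed by a map in `D'`. -/
def ClosedUnderIdentityTypes (D D' : MorphismProperty C) : Prop :=
  ∀ ⦃I : C⦄ ⦃X Y : DisplaySlice D I⦄ (k : X ⟶ Y), D' X.obj.hom → D' Y.obj.hom →
    ∃ (K : DisplaySlice D I) (i : X ⟶ K) (f : K ⟶ Y),
      D' K.obj.hom ∧ leftClass D I i ∧ sliceClass D D' I f ∧ i ≫ f = k

/-- The `u`-small maps: those that are pullbacks of `u`. -/
def smallMaps {U' U : C} (u : U' ⟶ U) : MorphismProperty C :=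
  fun X Y f => ∃ (a : X ⟶ U') (b : Y ⟶ U), IsPullback a f u b

/-- `u` is a universe in the display map category `(C, D)`. -/
structure IsUniverse (D : MorphismProperty C) {U' U : C} (u : U' ⟶ U) : Prop where
  isDisplayMapClass : IsDisplayMapClass D
  mem : D u
  isDisplayMapClass_smallMaps : IsDisplayMapClass (smallMaps u)

end DisplayMaps

/-! ### Reindexing in a fibration -/

section Reindexing

variable {B : Type u₁} [Category.{v₁} B] {E : Type u₂} [Category.{v₂} E]
variable (p : E ⥤ B) [p.IsFibered]

/-- The vertical map given by a map of `E` over an identity. -/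
def verticalHom {p : E ⥤ B} {I : B} {W X : p.Fiber I}
    (a : fiberInclusion.obj W ⟶ fiberInclusion.obj X) (ha : p.IsHomLift (𝟙 I) a) : W ⟶ X :=
  ⟨a, ha⟩

lemma map_verticalHom {p : E ⥤ B} {I : B} {W X : p.Fiber I}
    (a : fiberInclusion.obj W ⟶ fiberInclusion.obj X) (ha : p.IsHomLift (𝟙 I) a) :
    fiberInclusion.map (verticalHom a ha) = a :=
  rfl

/-- The object `h^* X` of the fibre over `I`. -/
noncomputable def reindexObj {I J : B} (h : I ⟶ J) (X : p.Fiber J) : p.Fiber I :=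
  ⟨IsPreFibered.pullbackObj X.2 h, IsPreFibered.pullbackObj_proj X.2 h⟩

/-- The chosen cartesian lift `h^* X ⟶ X` of `h : I ⟶ J`. -/
noncomputable def cart {I J : B} (h : I ⟶ J) (X : p.Fiber J) :
    fiberInclusion.obj (reindexObj p h X) ⟶ fiberInclusion.obj X :=
  IsPreFibered.pullbackMap X.2 h

instance {I J : B} (h : I ⟶ J) (X : p.Fiber J) : p.IsCartesian h (cart p h X) :=
  IsPreFibered.pullbackMap.IsCartesian X.2 h

lemma cart_comp_isHomLift {I J : B} (h : I ⟶ J) {X Y : p.Fiber J} (φ : X ⟶ Y) :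
    p.IsHomLift h (cart p h X ≫ fiberInclusion.map φ) := by
  have := IsHomLift.comp (p := p) h (𝟙 J) (cart p h X) (fiberInclusion.map φ)
  rwa [Category.comp_id] at this

/-- A map `W ⟶ X` of `E` over `h` corresponds to a vertical map `W ⟶ h^* X`. -/
noncomputable def reindexLift {I J : B} (h : I ⟶ J) {W : p.Fiber I} {X : p.Fiber J}
    (a : fiberInclusion.obj W ⟶ fiberInclusion.obj X) (ha : p.IsHomLift h a) :
    W ⟶ reindexObj p h X :=
  verticalHom (IsCartesian.map p h (cart p h X) a) inferInstance

lemma reindexLift_fac {I J : B} (h : I ⟶ J) {W : p.Fiber I} {X : p.Fiber J}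
    (a : fiberInclusion.obj W ⟶ fiberInclusion.obj X) (ha : p.IsHomLift h a) :
    fiberInclusion.map (reindexLift p h a ha) ≫ cart p h X = a :=
  IsCartesian.fac p h (cart p h X) a

lemma reindex_ext {I J : B} (h : I ⟶ J) {W : p.Fiber I} {X : p.Fiber J}
    {a b : W ⟶ reindexObj p h X}
    (e : fiberInclusion.map a ≫ cart p h X = fiberInclusion.map b ≫ cart p h X) : a = b :=
  Fiber.hom_ext (IsCartesian.ext p h (cart p h X) _ _ e)

/-- The reindexing functor `h^* : E(J) ⥤ E(I)`. -/
noncomputable def reindex {I J : B} (h : I ⟶ J) : p.Fiber J ⥤ p.Fiber I where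
  obj X := reindexObj p h X
  map {X _} φ := reindexLift p h (cart p h X ≫ fiberInclusion.map φ) (cart_comp_isHomLift p h φ)
  map_id X := by
    apply reindex_ext
    rw [reindexLift_fac, CategoryTheory.Functor.map_id, CategoryTheory.Functor.map_id,
      Category.comp_id, Category.id_comp]
  map_comp φ ψ := by
    apply reindex_ext
    rw [reindexLift_fac, CategoryTheory.Functor.map_comp, CategoryTheory.Functor.map_comp,
      Category.assoc, reindexLift_fac, ← Category.assoc, ← Category.assoc, reindexLift_fac]

lemma reindex_map_cart {I J : B} (h : I ⟶ J) {X Y : p.Fiber J} (φ : X ⟶ Y) :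
    fiberInclusion.map ((reindex p h).map φ) ≫ cart p h Y =
      cart p h X ≫ fiberInclusion.map φ :=
  reindexLift_fac p h _ (cart_comp_isHomLift p h φ)

lemma cart_comp_cart_isCartesian {I Q J : B} (s : I ⟶ Q) (q : Q ⟶ J) (h : I ⟶ J)
    (e : s ≫ q = h) (X : p.Fiber J) :
    p.IsCartesian h (cart p s (reindexObj p q X) ≫ cart p q X) := by
  subst e
  exact IsFibered.comp s q (cart p s (reindexObj p q X)) (cart p q X)

/-- The canonical isomorphism `s^* (q^* X) ≅ h^* X` for `s ≫ q = h`. -/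
noncomputable def reindexCompApp {I Q J : B} (s : I ⟶ Q) (q : Q ⟶ J) (h : I ⟶ J)
    (e : s ≫ q = h) (X : p.Fiber J) :
    reindexObj p s (reindexObj p q X) ≅ reindexObj p h X :=
  haveI := cart_comp_cart_isCartesian p s q h e X
  { hom := reindexLift p h (cart p s (reindexObj p q X) ≫ cart p q X) inferInstance
    inv := verticalHom
      (IsCartesian.map p h (cart p s (reindexObj p q X) ≫ cart p q X) (cart p h X)) inferInstance
    hom_inv_id := by
      apply Fiber.hom_ext
      apply IsCartesian.ext p h (cart p s (reindexObj p q X) ≫ cart p q X)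
      rw [CategoryTheory.Functor.map_comp, map_verticalHom, Category.assoc, IsCartesian.fac, reindexLift_fac,
        CategoryTheory.Functor.map_id, Category.id_comp]
    inv_hom_id := by
      apply reindex_ext
      rw [CategoryTheory.Functor.map_comp, Category.assoc, reindexLift_fac, map_verticalHom, IsCartesian.fac,
        CategoryTheory.Functor.map_id, Category.id_comp] }

lemma reindexCompApp_hom_fac {I Q J : B} (s : I ⟶ Q) (q : Q ⟶ J) (h : I ⟶ J)
    (e : s ≫ q = h) (X : p.Fiber J) :
    fiberInclusion.map (reindexCompApp p s q h e X).hom ≫ cart p h X =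
      cart p s (reindexObj p q X) ≫ cart p q X :=
  haveI := cart_comp_cart_isCartesian p s q h e X
  reindexLift_fac p h _ inferInstance

/-- The canonical natural isomorphism `s^* q^* ≅ h^*` for `s ≫ q = h`. -/
noncomputable def reindexComp {I Q J : B} (s : I ⟶ Q) (q : Q ⟶ J) (h : I ⟶ J)
    (e : s ≫ q = h) : reindex p q ⋙ reindex p s ≅ reindex p h :=
  NatIso.ofComponents (fun X => reindexCompApp p s q h e X) (by
    intro X Y φ
    apply reindex_ext
    have h₁ := reindex_map_cart p s ((reindex p q).map φ)
    have h₂ := reindex_map_cart p q φ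
    have h₃ := reindex_map_cart p h φ
    have h₄ := reindexCompApp_hom_fac p s q h e X
    have h₅ := reindexCompApp_hom_fac p s q h e Y
    refine (congrArg (· ≫ cart p h Y) (CategoryTheory.Functor.map_comp _ _ _)).trans ?_
    refine Eq.trans ?_ (congrArg (· ≫ cart p h Y) (CategoryTheory.Functor.map_comp _ _ _)).symm
    refine (Category.assoc _ _ _).trans ((congrArg _ h₅).trans ?_)
    refine Eq.trans ?_ (Category.assoc _ _ _).symm
    refine Eq.trans ?_ (congrArg _ h₃).symm
    refine Eq.trans ?_ (Category.assoc _ _ _)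
    refine Eq.trans ?_ (congrArg (· ≫ fiberInclusion.map φ) h₄).symm
    refine (Category.assoc _ _ _).symm.trans ((congrArg (· ≫ cart p q Y) h₁).trans ?_)
    refine (Category.assoc _ _ _).trans ((congrArg _ h₂).trans ?_)
    exact (Category.assoc _ _ _).symm)

/-- For a commutative square `f' ≫ h = h' ≫ f`, the canonical isomorphism
`f'^* h^* ≅ h'^* f^*`. -/
noncomputable def reindexSquare {B' A' B₀ A₀ : B} (f' : B' ⟶ A') (h : A' ⟶ A₀) (h' : B' ⟶ B₀)
    (f : B₀ ⟶ A₀) (e : f' ≫ h = h' ≫ f) :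
    reindex p h ⋙ reindex p f' ≅ reindex p f ⋙ reindex p h' :=
  reindexComp p f' h (f' ≫ h) rfl ≪≫ (reindexComp p h' f (f' ≫ h) e.symm).symm

/-- `p` has `D`-products: for every `f` in `D` the functor `f^*` has a right adjoint `∏_f`, and for
every pullback square with `f`, `f'` in `D` the Beck–Chevalley transformation
`h^* ∏_f ⟶ ∏_f' h'^*` is invertible. -/
structure HasProductsAlong (D : MorphismProperty B) : Prop where
  isLeftAdjoint : ∀ ⦃B₀ A₀ : B⦄ (f : B₀ ⟶ A₀), D f → (reindex p f).IsLeftAdjoint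
  beckChevalley : ∀ ⦃B' A' B₀ A₀ : B⦄ (f' : B' ⟶ A') (h : A' ⟶ A₀) (h' : B' ⟶ B₀)
    (f : B₀ ⟶ A₀) (sq : IsPullback h' f' f h), D f → D f' →
    ∀ (R : p.Fiber B₀ ⥤ p.Fiber A₀) (R' : p.Fiber B' ⥤ p.Fiber A')
      (adj : reindex p f ⊣ R) (adj' : reindex p f' ⊣ R'),
      IsIso (mateEquiv adj adj' (TwoSquare.mk _ _ _ _
        (reindexSquare p f' h h' f sq.w.symm).hom)).natTrans

/-- The family `𝓕` of classes of vertical maps is closed under products along maps in `D`. -/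
def ClosedUnderProductsAlong (D : MorphismProperty B) (𝓕 : ∀ I : B, MorphismProperty (p.Fiber I)) :
    Prop :=
  ∀ ⦃B₀ A₀ : B⦄ (f : B₀ ⟶ A₀), D f → ∀ (R : p.Fiber B₀ ⥤ p.Fiber A₀), (reindex p f ⊣ R) →
    ∀ ⦃Y X : p.Fiber B₀⦄ (φ : Y ⟶ X), 𝓕 B₀ φ → 𝓕 A₀ (R.map φ)

end Reindexing

/-! ### Fibred display map categories and gluing -/

section Fibred

variable {B : Type u₁} [Category.{v₁} B] {E : Type u₂} [Category.{v₂} E]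
variable (p : E ⥤ B) [p.IsFibered]

/-- A fibred display map category: each `ℰ I` is a class of display maps in the fibre `E(I)`, and
reindexing preserves display maps and pullbacks of display maps. -/
structure IsFibredDisplayMapClass (ℰ : ∀ I : B, MorphismProperty (p.Fiber I)) : Prop where
  isDisplayMapClass : ∀ I : B, IsDisplayMapClass (ℰ I)
  map_mem : ∀ ⦃I J : B⦄ (h : I ⟶ J) ⦃Y X : p.Fiber J⦄ (φ : Y ⟶ X), ℰ J φ →
    ℰ I ((reindex p h).map φ)
  map_isPullback : ∀ ⦃I J : B⦄ (h : I ⟶ J) ⦃Y' Y X' X : p.Fiber J⦄ (t : Y' ⟶ Y) (φ' : Y' ⟶ X')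
    (φ : Y ⟶ X) (s : X' ⟶ X), ℰ J φ → IsPullback t φ' φ s →
    IsPullback ((reindex p h).map t) ((reindex p h).map φ') ((reindex p h).map φ)
      ((reindex p h).map s)

/-- An object of `E` as an object of its fibre. -/
def toFiber (X : E) : p.Fiber (p.obj X) := ⟨X, rfl⟩

/-- The vertical component `X ⟶ p(f)^* A` of a map `f : X ⟶ A` of `E`. -/
noncomputable def verticalPart {X A : E} (f : X ⟶ A) :
    toFiber p X ⟶ (reindex p (p.map f)).obj (toFiber p A) :=
  reindexLift p (p.map f) (W := toFiber p X) (X := toFiber p A) f (IsHomLift.map p f)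

/-- The maps of `E` lying over a map in `D` and with vertical component in `ℰ`. For classes of
display maps `D` and `ℰ` this is the class of display maps of the glued display map category. -/
def gluedMaps (D : MorphismProperty B) (ℰ : ∀ I : B, MorphismProperty (p.Fiber I)) :
    MorphismProperty E :=
  fun X _ f => D (p.map f) ∧ ℰ (p.obj X) (verticalPart p f)

/-- Fibrewise identity types: each fibre has identity types, and reindexing preserves the (global)
left classes of the fibres. -/
def HasFibrewiseIdentityTypes (ℰ : ∀ I : B, MorphismProperty (p.Fiber I)) : Prop :=
  (∀ I : B, HasIdentityTypes (ℰ I)) ∧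
    ∀ ⦃I J : B⦄ (h : I ⟶ J) ⦃Y X : p.Fiber J⦄ (m : Y ⟶ X), (ℰ J).llp m →
      (ℰ I).llp ((reindex p h).map m)

/-- The left map condition: for a left map `m : I ⟶ J` of the base and `X` in `E(J)`, the functor
`ℰ_J / X ⥤ ℰ_I / m^* X` induced by reindexing is full. -/
def LeftMapCondition (D : MorphismProperty B) (ℰ : ∀ I : B, MorphismProperty (p.Fiber I)) : Prop :=
  ∀ ⦃I J : B⦄ (m : I ⟶ J), D.llp m → ∀ (X : p.Fiber J) (Y Y' : Over X),
    ℰ J Y.hom → ℰ J Y'.hom →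
      Function.Surjective
        (fun k : Y ⟶ Y' => (Over.post (X := X) (reindex p m)).map k)

/-- A pair `(s, t)` of a lift `s` of `h : I' ⟶ I` through `q : Q ⟶ I` (for `h = 𝟙`: a section of
`q`) and a map `t : w ⟶ s^* π` in the slice over `h^* X`, where `s^* q^* X` is identified with
`h^* X` by the canonical isomorphism. -/
structure SectionPair {I : B} {X : p.Fiber I} {Q : B} (q : Q ⟶ I) {P : p.Fiber Q}
    (π : P ⟶ (reindex p q).obj X) {I' : B} (h : I' ⟶ I) {W : p.Fiber I'}
    (w : W ⟶ (reindex p h).obj X) where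
  s : I' ⟶ Q
  s_comp : s ≫ q = h
  t : W ⟶ (reindex p s).obj P
  t_comp : t ≫ (reindex p s).map π ≫ (reindexComp p s q h s_comp).hom.app X = w

/-- The map `W ⟶ P` of `E` over `s` corresponding to `t : W ⟶ s^* P`. -/
noncomputable def SectionPair.toTotal {p : E ⥤ B} [p.IsFibered] {I : B} {X : p.Fiber I} {Q : B}
    {q : Q ⟶ I} {P : p.Fiber Q}
    {π : P ⟶ (reindex p q).obj X} {I' : B} {h : I' ⟶ I} {W : p.Fiber I'}
    {w : W ⟶ (reindex p h).obj X} (x : SectionPair p q π h w) :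
    fiberInclusion.obj W ⟶ fiberInclusion.obj P :=
  fiberInclusion.map x.t ≫ cart p x.s P

/-- A quasifibred product of `ψ : Z ⟶ Y` along `φ : Y ⟶ X` in the fibre over `I`, stable under
reindexing: a display map `q : Q ⟶ I` and a display map `π : P ⟶ q^* X` over `Q` together with, for
every `h : I' ⟶ I` and `w : W ⟶ h^* X` in `E(I')`, a bijection between maps
`(h^* φ)^* w ⟶ h^* ψ` over `h^* Y` and pairs `(s, t)` as in `SectionPair`. Sections of the reindexed
`h^* q` are lifts of `h` through `q`, so for each `h` this is the universal property of the
reindexed data; the case `h = 𝟙` is that of the data itself. The pullback `(h^* φ)^* w` ranges over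
all its representatives `(T, a, b)`. Naturality in `W` is the case `g = 𝟙` of `naturality`, and its
general case is compatibility with reindexing along `g`. -/
structure QuasifibredPi (D : MorphismProperty B) (ℰ : ∀ I : B, MorphismProperty (p.Fiber I))
    {I : B} {Z Y X : p.Fiber I} (ψ : Z ⟶ Y) (φ : Y ⟶ X) where
  Q : B
  q : Q ⟶ I
  q_mem : D q
  P : p.Fiber Q
  π : P ⟶ (reindex p q).obj X
  π_mem : ℰ Q π
  bij : ∀ {I' : B} (h : I' ⟶ I) {W T : p.Fiber I'} (w : W ⟶ (reindex p h).obj X)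
    (a : T ⟶ (reindex p h).obj Y) (b : T ⟶ W) (_ : IsPullback b a w ((reindex p h).map φ)),
    {m : T ⟶ (reindex p h).obj Z // m ≫ (reindex p h).map ψ = a} ≃ SectionPair p q π h w
  naturality : ∀ {I' I'' : B} (h : I' ⟶ I) (g : I'' ⟶ I') (h' : I'' ⟶ I) (_ : g ≫ h = h')
    {W T : p.Fiber I'} (w : W ⟶ (reindex p h).obj X) (a : T ⟶ (reindex p h).obj Y) (b : T ⟶ W)
    (sq : IsPullback b a w ((reindex p h).map φ))
    {W' T' : p.Fiber I''} (w' : W' ⟶ (reindex p h').obj X) (a' : T' ⟶ (reindex p h').obj Y)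
    (b' : T' ⟶ W') (sq' : IsPullback b' a' w' ((reindex p h').map φ))
    (c : fiberInclusion.obj W' ⟶ fiberInclusion.obj W) (_ : p.IsHomLift g c)
    (_ : c ≫ fiberInclusion.map w ≫ cart p h X = fiberInclusion.map w' ≫ cart p h' X)
    (e : fiberInclusion.obj T' ⟶ fiberInclusion.obj T) (_ : p.IsHomLift g e)
    (_ : e ≫ fiberInclusion.map b = fiberInclusion.map b' ≫ c)
    (_ : e ≫ fiberInclusion.map a ≫ cart p h Y = fiberInclusion.map a' ≫ cart p h' Y)
    (m : {m : T ⟶ (reindex p h).obj Z // m ≫ (reindex p h).map ψ = a})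
    (m' : {m : T' ⟶ (reindex p h').obj Z // m ≫ (reindex p h').map ψ = a'})
    (_ : e ≫ fiberInclusion.map m.1 ≫ cart p h Z = fiberInclusion.map m'.1 ≫ cart p h' Z),
    (bij h' w' a' b' sq' m').s = g ≫ (bij h w a b sq m).s ∧
      (bij h' w' a' b' sq' m').toTotal = c ≫ (bij h w a b sq m).toTotal

variable {p}

/-- The `v`-small maps of `E(I)`: the pullbacks in `E(I)` of `f^* v` for some `f : I ⟶ Ω`. -/
def fibreSmallMaps {Ω : B} {V' V : p.Fiber Ω} (v : V' ⟶ V) (I : B) :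
    MorphismProperty (p.Fiber I) :=
  fun _ _ φ => ∃ f : I ⟶ Ω, smallMaps ((reindex p f).map v) φ

/-- `(Ω, v)` is a quasifibred universe: `v` is a display map, and all vertical isomorphisms are
`v`-small. -/
structure IsQuasifibredUniverse (ℰ : ∀ I : B, MorphismProperty (p.Fiber I)) {Ω : B}
    {V' V : p.Fiber Ω} (v : V' ⟶ V) : Prop where
  mem : ℰ Ω v
  iso_small : ∀ ⦃I : B⦄ ⦃Y X : p.Fiber I⦄ (φ : Y ⟶ X), IsIso φ → fibreSmallMaps v I φ

end Fibred

end Gluing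

open Gluing

namespace Gluing

open CategoryTheory.Functor CategoryTheory.Functor.Fiber

section

variable {C : Type u₁} [Category.{v₁} C]

/-! Every map of `E` is a vertical map followed by a cartesian one, and a glued map is one whose
base map lies in `D` and whose vertical factor lies in `ℰ`; by `gluedMaps_iff` any such
factorization may be used as a test. The `u`-small maps form a class of display maps and the
`v`-small maps a fibred one (`IsQuasifibredUniverse.isFibredDisplayMapClass`). Hence the prospective
small maps are `gluedMaps` for this smaller pair, and closure under type constructors becomes a
question about gluing in general.

Existence of the universe (`exists_smallMaps_eq_gluedMaps`): a small map into `A` over `I` amounts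
to a `u`-small `h : J ⟶ I`, a map `g : J ⟶ Ω` and a vertical map `h^* A ⟶ g^* V`. The pairs `(h, g)`
are the pullbacks of a generic pair over the product `R` of the projection `Ω × U' ⟶ U'` along `u`;
well-rootedness makes this projection a display map. If `k : S ⟶ R` is the generic small map and `N`
is `V` reindexed to `S`, the remaining datum transposes to a map `A ⟶ ∏_k N` of `E`, where
Beck–Chevalley allows the base to vary (`HasProductsAlong.existsUnique`). So `∏_k N` is the codomain
of the universe, and `v` pulled back along the counit is its vertical part.

For `Σ`-types, vertical parts compose after reindexing. For `Π`-types, the product along a vertical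
map followed by a cartesian one is an iterated product (`IsPi.comp`): along the vertical map it is a
quasifibred product (`QuasifibredPi.exists_isPi`), along the cartesian map it is a product in the
base combined with a fibrewise one (`exists_isPi_cartMap`).

For identity types, vertical left maps and cartesian lifts of left maps are left maps of the glued
category, the latter by the left map condition. To factor `k : X ⟶ Y`, factor its base map as a left
map `i₀` followed by `f₀`. A retraction `r` of `i₀` extends `X` to `r^* X`, the left map condition
extends `k` to a vertical map `r^* X ⟶ f₀^* Y`, and this is factored in its fibre. -/

lemma isPullback_of_existsUnique {P X Y Z : C} {fst : P ⟶ X} {snd : P ⟶ Y} {f : X ⟶ Z} {g : Y ⟶ Z}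
    (w : fst ≫ f = snd ≫ g)
    (h : ∀ {W : C} (a : W ⟶ X) (b : W ⟶ Y), a ≫ f = b ≫ g →
      ∃! d : W ⟶ P, d ≫ fst = a ∧ d ≫ snd = b) :
    IsPullback fst snd f g :=
  ⟨⟨w⟩, ⟨PullbackCone.IsLimit.mk w (fun t => (h t.fst t.snd t.condition).choose)
    (fun t => (h t.fst t.snd t.condition).choose_spec.1.1)
    (fun t => (h t.fst t.snd t.condition).choose_spec.1.2)
    (fun t m h₁ h₂ => (h t.fst t.snd t.condition).choose_spec.2 m ⟨h₁, h₂⟩)⟩⟩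

end

/-! ### Cartesian and vertical maps in the total category -/

section Total

variable {B : Type u₁} [Category.{v₁} B] {E : Type u₂} [Category.{v₂} E]
variable {p : E ⥤ B}

lemma isHomLift_unique {R S : B} {a b : E} {f f' : R ⟶ S} {φ : a ⟶ b}
    (h : p.IsHomLift f φ) (h' : p.IsHomLift f' φ) : f = f' := by
  rw [IsHomLift.fac p f φ, IsHomLift.fac p f' φ]

lemma isHomLift_comp {R S T : B} {a b c : E} {f : R ⟶ S} {g : S ⟶ T} {k : R ⟶ T} (e : f ≫ g = k)
    {φ : a ⟶ b} {ψ : b ⟶ c} (hφ : p.IsHomLift f φ) (hψ : p.IsHomLift g ψ) :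
    p.IsHomLift k (φ ≫ ψ) := by
  subst e
  infer_instance

lemma exists_isHomLift {I J : B} {W Y : E} (hW : p.obj W = I) (hY : p.obj Y = J) (a : W ⟶ Y) :
    ∃ a₀ : I ⟶ J, p.IsHomLift a₀ a := by
  subst hW hY
  exact ⟨p.map a, inferInstance⟩

lemma exists_isHomLift_fiber {I J : B} {W : p.Fiber I} {Y : p.Fiber J}
    (a : fiberInclusion.obj W ⟶ fiberInclusion.obj Y) : ∃ a₀ : I ⟶ J, p.IsHomLift a₀ a :=
  exists_isHomLift W.2 Y.2 a

/-- Composing with a vertical map does not change the base map. This is how base maps of unknown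
arrows are read off from commutative squares. -/
lemma isHomLift_of_comp_vertical {R S : B} {a b c : E} (hb : p.obj b = S) {f : R ⟶ S}
    {φ : a ⟶ b} {ψ : b ⟶ c} (hψ : p.IsHomLift (𝟙 S) ψ) (h : p.IsHomLift f (φ ≫ ψ)) :
    p.IsHomLift f φ := by
  obtain rfl := IsHomLift.domain_eq p f (φ ≫ ψ)
  obtain ⟨f', hf'⟩ := exists_isHomLift rfl hb φ
  have := isHomLift_unique h (isHomLift_comp (Category.comp_id _) hf' hψ)
  rwa [this]

lemma IsStronglyCartesian.exists_lift {R R' S : B} {a b a' : E} {f : R ⟶ S} {φ : a ⟶ b}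
    (hφ : p.IsStronglyCartesian f φ) {g : R' ⟶ R} {f' : R' ⟶ S} (e : g ≫ f = f') {φ' : a' ⟶ b}
    (hφ' : p.IsHomLift f' φ') : ∃ χ : a' ⟶ a, p.IsHomLift g χ ∧ χ ≫ φ = φ' :=
  (IsStronglyCartesian.universal_property p f φ g f' e.symm φ').exists

lemma IsStronglyCartesian.hom_ext {R R' S : B} {a b a' : E} {f : R ⟶ S} {φ : a ⟶ b}
    (hφ : p.IsStronglyCartesian f φ) {g : R' ⟶ R} {χ χ' : a' ⟶ a}
    (h : p.IsHomLift g χ) (h' : p.IsHomLift g χ') (e : χ ≫ φ = χ' ≫ φ) : χ = χ' :=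
  IsStronglyCartesian.ext p f φ g e

/-- To check that a square of `E` is a pullback it suffices to test on objects of the fibres. -/
lemma isPullback_of_existsUnique_fiber {P X Y Z : E} {fst : P ⟶ X} {snd : P ⟶ Y} {f : X ⟶ Z}
    {g : Y ⟶ Z} (w : fst ≫ f = snd ≫ g)
    (h : ∀ {I : B} {W : p.Fiber I} (a : fiberInclusion.obj W ⟶ X) (b : fiberInclusion.obj W ⟶ Y),
      a ≫ f = b ≫ g →
        ∃! d : fiberInclusion.obj W ⟶ P, d ≫ fst = a ∧ d ≫ snd = b) :
    IsPullback fst snd f g :=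
  isPullback_of_existsUnique w fun {W} a b e => h (W := toFiber p W) a b e

/-- A commutative square of `E` over a pullback square of `B`, with two opposite sides cartesian,
is a pullback square. -/
lemma isPullback_of_isStronglyCartesian {I' I J' J : B} {f' : J' ⟶ J} {g' : J' ⟶ I'} {g : J ⟶ I}
    {f : I' ⟶ I} (sq : IsPullback f' g' g f) {Y' Y X A : E} {s' : Y' ⟶ Y} {c' : Y' ⟶ X}
    {c : Y ⟶ A} {s : X ⟶ A} (hs' : p.IsHomLift f' s') (hc' : p.IsStronglyCartesian g' c')
    (hc : p.IsStronglyCartesian g c) (hs : p.IsHomLift f s) (w : s' ≫ c = c' ≫ s) :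
    IsPullback s' c' c s := by
  refine isPullback_of_existsUnique w fun {W} a b e => ?_
  obtain ⟨a₀, ha⟩ := exists_isHomLift rfl (IsHomLift.domain_eq p g c) a
  obtain ⟨b₀, hb⟩ := exists_isHomLift rfl (IsHomLift.domain_eq p f s) b
  have e₀ : a₀ ≫ g = b₀ ≫ f :=
    isHomLift_unique (isHomLift_comp rfl ha hc.toIsHomLift) (e ▸ isHomLift_comp rfl hb hs)
  obtain ⟨d, hd, hd'⟩ := IsStronglyCartesian.exists_lift hc' (sq.lift_snd a₀ b₀ e₀) hb
  refine ⟨d, ⟨?_, hd'⟩, ?_⟩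
  · refine IsStronglyCartesian.hom_ext hc (isHomLift_comp (sq.lift_fst a₀ b₀ e₀) hd hs') ha ?_
    rw [Category.assoc, w, ← Category.assoc, hd', e]
  · rintro d' ⟨h₁, h₂⟩
    obtain ⟨d₀, hd₀⟩ := exists_isHomLift rfl (IsHomLift.domain_eq p f' s') d'
    have : d₀ = sq.lift a₀ b₀ e₀ := sq.hom_ext
      ((isHomLift_unique (isHomLift_comp rfl hd₀ hs') (h₁ ▸ ha)).trans (sq.lift_fst _ _ _).symm)
      ((isHomLift_unique (isHomLift_comp rfl hd₀ hc'.toIsHomLift) (h₂ ▸ hb)).trans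
        (sq.lift_snd _ _ _).symm)
    subst this
    exact IsStronglyCartesian.hom_ext hc' hd₀ hd (h₂.trans hd'.symm)

lemma map_isHomLift_id {I : B} {X Y : p.Fiber I} (φ : X ⟶ Y) :
    p.IsHomLift (𝟙 I) (fiberInclusion.map φ) :=
  inferInstance

lemma exists_vertical {I J : B} {W Y : p.Fiber I} {A : E} {h : I ⟶ J}
    {c : fiberInclusion.obj Y ⟶ A} (hc : p.IsStronglyCartesian h c)
    {a : fiberInclusion.obj W ⟶ A} (ha : p.IsHomLift h a) :
    ∃ a' : W ⟶ Y, fiberInclusion.map a' ≫ c = a := by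
  obtain ⟨χ, hχ, e⟩ := IsStronglyCartesian.exists_lift hc (Category.id_comp h) ha
  exact ⟨verticalHom χ hχ, e⟩

lemma vertical_ext {I J : B} {W Y : p.Fiber I} {A : E} {h : I ⟶ J}
    {c : fiberInclusion.obj Y ⟶ A} (hc : p.IsStronglyCartesian h c) {a b : W ⟶ Y}
    (e : fiberInclusion.map a ≫ c = fiberInclusion.map b ≫ c) : a = b :=
  Fiber.hom_ext (IsStronglyCartesian.hom_ext hc (map_isHomLift_id a) (map_isHomLift_id b) e)

lemma isStronglyCartesian_comp {I J K : B} {h : I ⟶ J} {k : J ⟶ K} {l : I ⟶ K} (e : h ≫ k = l)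
    {X Y Z : E} {c : X ⟶ Y} {d : Y ⟶ Z} (hc : p.IsStronglyCartesian h c)
    (hd : p.IsStronglyCartesian k d) : p.IsStronglyCartesian l (c ≫ d) := by
  subst e
  infer_instance

lemma isHomLift_of_comp_map {R S : B} {W : E} {Y X : p.Fiber S} {f : R ⟶ S}
    {a : W ⟶ fiberInclusion.obj Y} (φ : Y ⟶ X) (h : p.IsHomLift f (a ≫ fiberInclusion.map φ)) :
    p.IsHomLift f a :=
  isHomLift_of_comp_vertical Y.2 (map_isHomLift_id φ) h

lemma isStronglyCartesian_id {I : B} (X : p.Fiber I) :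
    p.IsStronglyCartesian (𝟙 I) (𝟙 (fiberInclusion.obj X)) :=
  have : p.IsHomLift (𝟙 I) (𝟙 (fiberInclusion.obj X)) := map_isHomLift_id (𝟙 X)
  inferInstance

end Total

/-! ### Reindexing squares and fibrewise pullbacks in the total category -/

section Fibred

variable {B : Type u₁} [Category.{v₁} B] {E : Type u₂} [Category.{v₂} E]
variable {p : E ⥤ B} [p.IsFibered]

/-- The chosen cartesian lift `h^* X ⟶ X`, with domain written as a value of `reindex p h`. -/
noncomputable def cartMap {I J : B} (h : I ⟶ J) (X : p.Fiber J) :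
    fiberInclusion.obj ((reindex p h).obj X) ⟶ fiberInclusion.obj X :=
  cart p h X

lemma cartMap_isCartesian {I J : B} (h : I ⟶ J) (X : p.Fiber J) :
    p.IsStronglyCartesian h (cartMap h X) :=
  inferInstanceAs (p.IsStronglyCartesian h (cart p h X))

lemma cartMap_isHomLift {I J : B} (h : I ⟶ J) (X : p.Fiber J) : p.IsHomLift h (cartMap h X) :=
  (cartMap_isCartesian h X).toIsHomLift

lemma map_reindex_map_comp_cartMap {I J : B} (h : I ⟶ J) {X Y : p.Fiber J} (φ : X ⟶ Y) :
    fiberInclusion.map ((reindex p h).map φ) ≫ cartMap h Y =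
      cartMap h X ≫ fiberInclusion.map φ :=
  reindex_map_cart p h φ

lemma map_reindex_map_comp_cartMap_assoc {I J : B} (h : I ⟶ J) {X Y : p.Fiber J} (φ : X ⟶ Y)
    {A : E} (k : fiberInclusion.obj Y ⟶ A) :
    fiberInclusion.map ((reindex p h).map φ) ≫ cartMap h Y ≫ k =
      cartMap h X ≫ fiberInclusion.map φ ≫ k := by
  rw [← Category.assoc, map_reindex_map_comp_cartMap, Category.assoc]

/-- The reindexed square of a vertical map is a pullback square of `E`. -/
lemma isPullback_reindex_map {I J : B} (h : I ⟶ J) {X Y : p.Fiber J} (φ : X ⟶ Y) :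
    IsPullback (cartMap h X) (fiberInclusion.map ((reindex p h).map φ)) (fiberInclusion.map φ)
      (cartMap h Y) :=
  (isPullback_of_isStronglyCartesian (IsPullback.of_horiz_isIso ⟨by simp⟩ :
      IsPullback (𝟙 I) h h (𝟙 J))
    (map_isHomLift_id _) (cartMap_isCartesian h X) (cartMap_isCartesian h Y)
    (map_isHomLift_id _) (map_reindex_map_comp_cartMap h φ)).flip

variable {ℰ : ∀ I : B, MorphismProperty (p.Fiber I)}

/-- Pullback squares of display maps in the fibres are pullback squares in the total category. -/
lemma IsFibredDisplayMapClass.isPullback_map (hℰ : IsFibredDisplayMapClass p ℰ) {J : B}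
    {Y' Y X' X : p.Fiber J} {t : Y' ⟶ Y} {φ' : Y' ⟶ X'} {φ : Y ⟶ X} {s : X' ⟶ X} (hφ : ℰ J φ)
    (sq : IsPullback t φ' φ s) :
    IsPullback (fiberInclusion.map t) (fiberInclusion.map φ') (fiberInclusion.map φ)
      (fiberInclusion.map s) := by
  refine isPullback_of_existsUnique_fiber (p := p)
    (by rw [← CategoryTheory.Functor.map_comp, ← CategoryTheory.Functor.map_comp, sq.w]) ?_
  · intro I W a b e
    -- As `s` and `φ` are vertical, `a` and `b` lie over the same `h`. They thus factor through the
    -- reindexed square, which is a pullback in the fibre over `I`.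
    obtain ⟨h, ha⟩ := exists_isHomLift_fiber a
    have hb : p.IsHomLift h b := isHomLift_of_comp_vertical X'.2 (map_isHomLift_id s)
      (e ▸ isHomLift_comp (Category.comp_id _) ha (map_isHomLift_id φ))
    have sq' := hℰ.map_isPullback h t φ' φ s hφ sq
    obtain ⟨a', rfl⟩ := exists_vertical (cartMap_isCartesian h Y) ha
    obtain ⟨b', rfl⟩ := exists_vertical (cartMap_isCartesian h X') hb
    have e' : a' ≫ (reindex p h).map φ = b' ≫ (reindex p h).map s := by
      apply vertical_ext (cartMap_isCartesian h X)
      simp only [CategoryTheory.Functor.map_comp, Category.assoc, map_reindex_map_comp_cartMap]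
      simpa only [Category.assoc] using e
    refine ⟨fiberInclusion.map (sq'.lift a' b' e') ≫ cartMap h Y', ⟨?_, ?_⟩, ?_⟩
    · rw [Category.assoc, ← map_reindex_map_comp_cartMap, ← Category.assoc,
        ← CategoryTheory.Functor.map_comp, sq'.lift_fst]
    · rw [Category.assoc, ← map_reindex_map_comp_cartMap, ← Category.assoc,
        ← CategoryTheory.Functor.map_comp, sq'.lift_snd]
    · rintro d ⟨h₁, h₂⟩
      have hd : p.IsHomLift h d := isHomLift_of_comp_vertical Y'.2 (map_isHomLift_id t) (h₁ ▸ ha)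
      obtain ⟨d', rfl⟩ := exists_vertical (cartMap_isCartesian h Y') hd
      congr 2
      apply sq'.hom_ext
      · rw [sq'.lift_fst]
        apply vertical_ext (cartMap_isCartesian h Y)
        rw [CategoryTheory.Functor.map_comp, Category.assoc, map_reindex_map_comp_cartMap, ← h₁,
          Category.assoc]
      · rw [sq'.lift_snd]
        apply vertical_ext (cartMap_isCartesian h X')
        rw [CategoryTheory.Functor.map_comp, Category.assoc, map_reindex_map_comp_cartMap, ← h₂,
          Category.assoc]

end Fibred

/-! ### The glued class of display maps -/

section

variable {B : Type u₁} [Category.{v₁} B] {E : Type u₂} [Category.{v₂} E]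
variable {p : E ⥤ B}

variable (p) in
lemma exists_fiber_obj (X : E) : ∃ (I : B) (X' : p.Fiber I), fiberInclusion.obj X' = X :=
  ⟨p.obj X, toFiber p X, rfl⟩

lemma isIso_of_isStronglyCartesian {I J : B} {W Y : p.Fiber I} {A : E} {h : I ⟶ J}
    {c : fiberInclusion.obj Y ⟶ A} (hc : p.IsStronglyCartesian h c)
    {c' : fiberInclusion.obj W ⟶ A} (hc' : p.IsStronglyCartesian h c') {a : W ⟶ Y}
    (e : fiberInclusion.map a ≫ c = c') : IsIso a := by
  obtain ⟨b, hb⟩ := exists_vertical hc' hc.toIsHomLift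
  refine ⟨b, vertical_ext hc' ?_, vertical_ext hc ?_⟩
  · rw [CategoryTheory.Functor.map_comp, CategoryTheory.Functor.map_id, Category.assoc, hb, e,
      Category.id_comp]
  · rw [CategoryTheory.Functor.map_comp, CategoryTheory.Functor.map_id, Category.assoc, e, hb,
      Category.id_comp]

variable [p.IsFibered] {D : MorphismProperty B} {ℰ : ∀ I : B, MorphismProperty (p.Fiber I)}

lemma IsFibredDisplayMapClass.respectsIso (hℰ : IsFibredDisplayMapClass p ℰ) (I : B) :
    (ℰ I).RespectsIso :=
  haveI := hℰ.isDisplayMapClass I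
  inferInstance

/-- Two cartesian lifts of the same base map differ by a vertical isomorphism, which `ℰ` does not
see. -/
lemma verticalPart_mem_iff (hℰ : IsFibredDisplayMapClass p ℰ) {X A : E} {f : X ⟶ A}
    {Y : p.Fiber (p.obj X)} {φ : toFiber p X ⟶ Y} {c : fiberInclusion.obj Y ⟶ A}
    (hc : p.IsStronglyCartesian (p.map f) c) (e : fiberInclusion.map φ ≫ c = f) :
    ℰ (p.obj X) (verticalPart p f) ↔ ℰ (p.obj X) φ := by
  have hr := hℰ.respectsIso (p.obj X)
  obtain ⟨k, hk⟩ := exists_vertical (cartMap_isCartesian (p.map f) (toFiber p A)) hc.toIsHomLift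
  have hiso := isIso_of_isStronglyCartesian (cartMap_isCartesian (p.map f) (toFiber p A)) hc hk
  have : verticalPart p f = φ ≫ k := by
    apply vertical_ext (cartMap_isCartesian (p.map f) (toFiber p A))
    rw [CategoryTheory.Functor.map_comp, Category.assoc, hk]
    exact (reindexLift_fac p (p.map f) (W := toFiber p X) (X := toFiber p A) f _).trans e.symm
  rw [this]
  exact MorphismProperty.cancel_right_of_respectsIso _ _ _

/-- The working form of `gluedMaps`: any cartesian lift may be used, and the base objects need not
be literally of the form `p.obj X`. -/
lemma gluedMaps_iff (hℰ : IsFibredDisplayMapClass p ℰ) {I J : B} {X Y : p.Fiber I} {A : E}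
    {h : I ⟶ J} {φ : X ⟶ Y} {c : fiberInclusion.obj Y ⟶ A} (hc : p.IsStronglyCartesian h c)
    {f : fiberInclusion.obj X ⟶ A} (e : fiberInclusion.map φ ≫ c = f) :
    gluedMaps p D ℰ f ↔ D h ∧ ℰ I φ := by
  have hf : p.IsHomLift h f :=
    e ▸ isHomLift_comp (Category.id_comp h) (map_isHomLift_id φ) hc.toIsHomLift
  obtain rfl := IsHomLift.codomain_eq p h c
  obtain ⟨X, rfl⟩ := X
  change X ⟶ A at f
  change p.IsHomLift h f at hf
  obtain rfl : h = p.map f := IsHomLift.eq_of_isHomLift p h f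
  exact and_congr_right fun _ => verticalPart_mem_iff hℰ hc e

/-- Every map of `E` is a vertical map followed by a chosen cartesian one. -/
lemma exists_factorization {I J : B} {X : p.Fiber I} {A : p.Fiber J}
    (f : fiberInclusion.obj X ⟶ fiberInclusion.obj A) :
    ∃ (h : I ⟶ J) (φ : X ⟶ (reindex p h).obj A), fiberInclusion.map φ ≫ cartMap h A = f := by
  obtain ⟨h, hf⟩ := exists_isHomLift_fiber f
  exact ⟨h, exists_vertical (cartMap_isCartesian h A) hf⟩

lemma exists_factorization_of_gluedMaps (hℰ : IsFibredDisplayMapClass p ℰ) {I J : B}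
    {X : p.Fiber I} {A : p.Fiber J} {f : fiberInclusion.obj X ⟶ fiberInclusion.obj A}
    (hf : gluedMaps p D ℰ f) :
    ∃ (h : I ⟶ J) (φ : X ⟶ (reindex p h).obj A), D h ∧ ℰ I φ ∧
      fiberInclusion.map φ ≫ cartMap h A = f := by
  obtain ⟨h, φ, e⟩ := exists_factorization f
  obtain ⟨h₁, h₂⟩ := (gluedMaps_iff hℰ (cartMap_isCartesian h A) e).1 hf
  exact ⟨h, φ, h₁, h₂, e⟩

lemma gluedMaps_map (hℰ : IsFibredDisplayMapClass p ℰ) [D.ContainsIdentities] {I : B}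
    {X Y : p.Fiber I} {φ : X ⟶ Y} (hφ : ℰ I φ) : gluedMaps p D ℰ (fiberInclusion.map φ) := by
  have h : p.IsHomLift (𝟙 I) (𝟙 (fiberInclusion.obj Y)) := map_isHomLift_id (𝟙 Y)
  exact (gluedMaps_iff hℰ (h := 𝟙 I) (c := 𝟙 (fiberInclusion.obj Y)) inferInstance
    (Category.comp_id _)).2 ⟨D.id_mem I, hφ⟩

lemma gluedMaps_of_isStronglyCartesian (hℰ : IsFibredDisplayMapClass p ℰ) {I J : B}
    {X : p.Fiber I} {A : E} {h : I ⟶ J} (hh : D h) {c : fiberInclusion.obj X ⟶ A}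
    (hc : p.IsStronglyCartesian h c) : gluedMaps p D ℰ c :=
  haveI := hℰ.isDisplayMapClass I
  (gluedMaps_iff hℰ (φ := 𝟙 X) hc
    (by rw [CategoryTheory.Functor.map_id, Category.id_comp])).2 ⟨hh, (ℰ I).id_mem X⟩

/-- Moving `ψ` back past the cartesian lift of `h` turns it into `h^* ψ`, so the composite is `φ ≫
h^* ψ` followed by a composite of cartesian maps. -/
lemma gluedMaps_comp_iff (hℰ : IsFibredDisplayMapClass p ℰ) {I J K : B} {X : p.Fiber I}
    {Y : p.Fiber J} {Z : p.Fiber K} {h : I ⟶ J} {k : J ⟶ K}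
    {φ : X ⟶ (reindex p h).obj Y} {ψ : Y ⟶ (reindex p k).obj Z}
    {f : fiberInclusion.obj X ⟶ fiberInclusion.obj Y}
    {g : fiberInclusion.obj Y ⟶ fiberInclusion.obj Z}
    (ef : fiberInclusion.map φ ≫ cartMap h Y = f) (eg : fiberInclusion.map ψ ≫ cartMap k Z = g) :
    gluedMaps p D ℰ (f ≫ g) ↔ D (h ≫ k) ∧ ℰ I (φ ≫ (reindex p h).map ψ) := by
  refine gluedMaps_iff hℰ
    (isStronglyCartesian_comp rfl (cartMap_isCartesian h _) (cartMap_isCartesian k Z)) ?_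
  rw [CategoryTheory.Functor.map_comp, Category.assoc, map_reindex_map_comp_cartMap_assoc, eg,
    ← Category.assoc, ef]

lemma isIso_of_isIso_factorization {I J : B} {X : p.Fiber I} {A : p.Fiber J}
    {f : fiberInclusion.obj X ⟶ fiberInclusion.obj A} [IsIso f] {h : I ⟶ J}
    {φ : X ⟶ (reindex p h).obj A} (e : fiberInclusion.map φ ≫ cartMap h A = f) :
    IsIso h ∧ IsIso φ := by
  have hf : p.IsHomLift h f :=
    e ▸ isHomLift_comp (Category.id_comp h) (map_isHomLift_id φ) (cartMap_isHomLift h A)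
  have hh : IsIso h := IsHomLift.isIso_of_lift_isIso p h f
  exact ⟨hh, isIso_of_isStronglyCartesian (cartMap_isCartesian h A)
    (IsStronglyCartesian.of_isIso p h f) e⟩

lemma gluedMaps_respectsIso (hℰ : IsFibredDisplayMapClass p ℰ) [D.RespectsIso] :
    (gluedMaps p D ℰ).RespectsIso := by
  refine MorphismProperty.RespectsIso.mk _ ?_ ?_
  · intro X Y Z i g hg
    obtain ⟨I, X, rfl⟩ := exists_fiber_obj p X
    obtain ⟨J, Y, rfl⟩ := exists_fiber_obj p Y
    obtain ⟨K, Z, rfl⟩ := exists_fiber_obj p Z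
    obtain ⟨k, ψ, hk, hψ, eg⟩ := exists_factorization_of_gluedMaps hℰ hg
    obtain ⟨h, φ, ef⟩ := exists_factorization i.hom
    obtain ⟨_, _⟩ := isIso_of_isIso_factorization ef
    have := hℰ.respectsIso I
    rw [gluedMaps_comp_iff hℰ ef eg]
    exact ⟨(D.cancel_left_of_respectsIso h k).2 hk,
      ((ℰ I).cancel_left_of_respectsIso _ _).2 (hℰ.map_mem h ψ hψ)⟩
  · intro X Y Z i f hf
    obtain ⟨I, X, rfl⟩ := exists_fiber_obj p X
    obtain ⟨J, Y, rfl⟩ := exists_fiber_obj p Y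
    obtain ⟨K, Z, rfl⟩ := exists_fiber_obj p Z
    obtain ⟨h, φ, hh, hφ, ef⟩ := exists_factorization_of_gluedMaps hℰ hf
    obtain ⟨k, ψ, eg⟩ := exists_factorization i.hom
    obtain ⟨_, _⟩ := isIso_of_isIso_factorization eg
    have := hℰ.respectsIso I
    rw [gluedMaps_comp_iff hℰ ef eg]
    exact ⟨(D.cancel_right_of_respectsIso h k).2 hh,
      ((ℰ I).cancel_right_of_respectsIso _ _).2 hφ⟩

lemma gluedMaps_hasSigmaTypes (hℰ : IsFibredDisplayMapClass p ℰ) (hD : HasSigmaTypes D)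
    (h : ∀ I, HasSigmaTypes (ℰ I)) : HasSigmaTypes (gluedMaps p D ℰ) := by
  refine ⟨fun {X Y Z} f g hf hg => ?_⟩
  obtain ⟨I, X, rfl⟩ := exists_fiber_obj p X
  obtain ⟨J, Y, rfl⟩ := exists_fiber_obj p Y
  obtain ⟨K, Z, rfl⟩ := exists_fiber_obj p Z
  obtain ⟨h, φ, hh, hφ, ef⟩ := exists_factorization_of_gluedMaps hℰ hf
  obtain ⟨k, ψ, hk, hψ, eg⟩ := exists_factorization_of_gluedMaps hℰ hg
  rw [gluedMaps_comp_iff hℰ ef eg]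
  exact ⟨hD.comp_mem _ _ hh hk, (‹∀ I, HasSigmaTypes (ℰ I)› I).comp_mem _ _ hφ (hℰ.map_mem h ψ hψ)⟩

/-- Pullbacks of glued maps exist and are glued maps. -/
lemma exists_isPullback_of_gluedMaps [IsDisplayMapClass D] (hℰ : IsFibredDisplayMapClass p ℰ)
    {C A X : E} (g : C ⟶ A) (f : X ⟶ A) (hg : gluedMaps p D ℰ g) :
    ∃ (P : E) (t : P ⟶ C) (s : P ⟶ X), IsPullback t s g f ∧ gluedMaps p D ℰ s := by
  obtain ⟨J, C, rfl⟩ := exists_fiber_obj p C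
  obtain ⟨I, A, rfl⟩ := exists_fiber_obj p A
  obtain ⟨I', X, rfl⟩ := exists_fiber_obj p X
  obtain ⟨g₀, ψ, hg₀, hψ, rfl⟩ := exists_factorization_of_gluedMaps hℰ hg
  obtain ⟨f₀, φ, rfl⟩ := exists_factorization f
  have := MorphismProperty.HasPullbacks.hasPullback f₀ hg₀
  have sq₀ := IsPullback.of_hasPullback g₀ f₀
  set f' := pullback.fst g₀ f₀
  set g' := pullback.snd g₀ f₀
  -- the vertical map on `g'^* X` induced by the universal property of `f'^* g₀^* A`
  obtain ⟨s, hs, es⟩ := IsStronglyCartesian.exists_lift (cartMap_isCartesian g₀ A) sq₀.w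
    (φ' := cartMap g' X ≫ fiberInclusion.map φ ≫ cartMap f₀ A)
    (isHomLift_comp rfl (cartMap_isHomLift g' X)
      (isHomLift_comp (Category.id_comp _) (map_isHomLift_id φ) (cartMap_isHomLift f₀ A)))
  obtain ⟨s', rfl⟩ := exists_vertical (cartMap_isCartesian f' _) hs
  have := (hℰ.isDisplayMapClass (pullback g₀ f₀))
  have hψ' := hℰ.map_mem f' ψ hψ
  have := MorphismProperty.HasPullbacks.hasPullback s' hψ'
  -- The required square is pasted from three: a fibrewise pullback of `f'^* ψ`, the reindexing
  -- square of `ψ` along `f'`, and a square with two cartesian sides over the pullback in the base.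
  have sq₁ := hℰ.isPullback_map hψ' (IsPullback.of_hasPullback ((reindex p f').map ψ) s')
  have sq₂ := sq₁.paste_horiz (isPullback_reindex_map f' ψ)
  have sq₃ := sq₂.paste_vert (isPullback_of_isStronglyCartesian sq₀ hs
    (cartMap_isCartesian g' X) (cartMap_isCartesian g₀ A)
    (isHomLift_comp (Category.id_comp _) (map_isHomLift_id φ) (cartMap_isHomLift f₀ A)) es)
  exact ⟨_, _, _, sq₃, (gluedMaps_iff hℰ (cartMap_isCartesian g' X) rfl).2
    ⟨MorphismProperty.of_isPullback sq₀ hg₀,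
      MorphismProperty.of_isPullback (IsPullback.of_hasPullback _ s') hψ'⟩⟩

lemma gluedMaps_isDisplayMapClass [IsDisplayMapClass D] (hℰ : IsFibredDisplayMapClass p ℰ) :
    IsDisplayMapClass (gluedMaps p D ℰ) := by
  have := gluedMaps_respectsIso (D := D) hℰ
  have h₁ : (gluedMaps p D ℰ).ContainsIdentities := by
    refine ⟨fun X => ?_⟩
    obtain ⟨I, X, rfl⟩ := exists_fiber_obj p X
    have := hℰ.isDisplayMapClass I
    rw [← CategoryTheory.Functor.map_id]
    exact gluedMaps_map hℰ ((ℰ I).id_mem X)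
  have h₂ : (gluedMaps p D ℰ).HasPullbacks := by
    refine ⟨fun {X Y S} f {g} hg => ?_⟩
    obtain ⟨P, t, s, sq, -⟩ := exists_isPullback_of_gluedMaps hℰ _ g hg
    exact sq.hasPullback
  have h₃ : (gluedMaps p D ℰ).IsStableUnderBaseChange := by
    refine MorphismProperty.IsStableUnderBaseChange.of_forall_exists_isPullback ?_
    intro X Y Z f g _ hg
    obtain ⟨P, t, s, sq, hs⟩ := exists_isPullback_of_gluedMaps hℰ g f hg
    exact ⟨P, s, t, sq.flip, hs⟩
  exact {}

end

/-! ### Small maps as classes of display maps -/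

section

variable {C : Type u₁} [Category.{v₁} C]

lemma smallMaps_le {D : MorphismProperty C} [D.IsStableUnderBaseChange] {U' U : C} {u : U' ⟶ U}
    (hu : D u) : smallMaps u ≤ D :=
  fun _ _ _ ⟨_, _, sq⟩ => MorphismProperty.of_isPullback sq hu

lemma smallMaps_isStableUnderBaseChange {U' U : C} (u : U' ⟶ U) :
    (smallMaps u).IsStableUnderBaseChange :=
  ⟨fun sq ⟨_, _, sq'⟩ => ⟨_, _, sq.paste_horiz sq'⟩⟩

lemma hasPullbacks_of_le {D D' : MorphismProperty C} [D.HasPullbacks] (h : D' ≤ D) :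
    D'.HasPullbacks :=
  ⟨fun f hg => MorphismProperty.HasPullbacks.hasPullback f (h _ hg)⟩

end

section

variable {B : Type u₁} [Category.{v₁} B] {E : Type u₂} [Category.{v₂} E]
variable {p : E ⥤ B} [p.IsFibered] {D : MorphismProperty B}
  {ℰ : ∀ I : B, MorphismProperty (p.Fiber I)}

lemma fibreSmallMaps_le (hℰ : IsFibredDisplayMapClass p ℰ) {Ω : B} {V' V : p.Fiber Ω} {v : V' ⟶ V}
    (hv : ℰ Ω v) (I : B) : fibreSmallMaps v I ≤ ℰ I := by
  rintro X Y φ ⟨f, hφ⟩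
  have := hℰ.isDisplayMapClass I
  exact smallMaps_le (hℰ.map_mem f v hv) _ hφ

/-- This makes all results on glued maps available for small maps. Identities are small by
`iso_small`; reindexing along `h` replaces the classifying map `f` by `h ≫ f`. -/
lemma IsQuasifibredUniverse.isFibredDisplayMapClass (hℰ : IsFibredDisplayMapClass p ℰ) {Ω : B}
    {V' V : p.Fiber Ω} {v : V' ⟶ V} (hv : IsQuasifibredUniverse ℰ v) :
    IsFibredDisplayMapClass p (fibreSmallMaps v) where
  isDisplayMapClass I := by
    have := hℰ.isDisplayMapClass I
    have h₁ : (fibreSmallMaps v I).ContainsIdentities := ⟨fun X => hv.iso_small (𝟙 X) inferInstance⟩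
    have h₂ : (fibreSmallMaps v I).HasPullbacks :=
      hasPullbacks_of_le (fibreSmallMaps_le hℰ hv.mem I)
    have h₃ : (fibreSmallMaps v I).IsStableUnderBaseChange :=
      ⟨fun sq ⟨f, hf⟩ => ⟨f, (smallMaps_isStableUnderBaseChange _).of_isPullback sq hf⟩⟩
    exact {}
  map_mem := by
    rintro I J h Y X φ ⟨f, a, b, sq⟩
    refine ⟨h ≫ f, _, _, (hℰ.map_isPullback h _ _ _ _ (hℰ.map_mem f v hv.mem) sq).paste_horiz
      (IsPullback.of_horiz_isIso ⟨((reindexComp p h f (h ≫ f) rfl).hom.naturality v).symm⟩)⟩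
  map_isPullback I J h Y' Y X' X t φ' φ s hφ sq :=
    hℰ.map_isPullback h t φ' φ s (fibreSmallMaps_le hℰ hv.mem J _ hφ) sq

/-! ### Fibred products seen from the total category -/

lemma map_reindexComp_hom_app_comp_cartMap {I Q J : B} (s : I ⟶ Q) (q : Q ⟶ J) (h : I ⟶ J)
    (e : s ≫ q = h) (X : p.Fiber J) :
    fiberInclusion.map ((reindexComp p s q h e).hom.app X) ≫ cartMap h X =
      cartMap s ((reindex p q).obj X) ≫ cartMap q X :=
  reindexCompApp_hom_fac p s q h e X

lemma map_reindexSquare_hom_app_comp_cartMap {B' A' B₀ A₀ : B} (f' : B' ⟶ A') (h : A' ⟶ A₀)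
    (h' : B' ⟶ B₀) (f : B₀ ⟶ A₀) (e : f' ≫ h = h' ≫ f) (X : p.Fiber A₀) :
    fiberInclusion.map ((reindexSquare p f' h h' f e).hom.app X) ≫
        cartMap h' ((reindex p f).obj X) ≫ cartMap f X =
      cartMap f' ((reindex p h).obj X) ≫ cartMap h X := by
  rw [← map_reindexComp_hom_app_comp_cartMap f' h (f' ≫ h) rfl X,
    ← map_reindexComp_hom_app_comp_cartMap h' f (f' ≫ h) e.symm X, ← Category.assoc,
    ← CategoryTheory.Functor.map_comp]
  congr 2
  simp [reindexSquare]

/-- The universal property of `∏_f N` in the total category, for varying base: maps `W ⟶ ∏_f N`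
over `h` correspond to maps `T ⟶ N` over `h'`, where `h'` is the pullback of `h` along `f` and
`T ⟶ W` is cartesian over the pullback of `f` along `h`. -/
lemma HasProductsAlong.existsUnique (hp : HasProductsAlong p D) [D.IsStableUnderBaseChange]
    {B₀ A₀ : B} {f : B₀ ⟶ A₀} (hf : D f) {R : p.Fiber B₀ ⥤ p.Fiber A₀} (adj : reindex p f ⊣ R)
    (N : p.Fiber B₀) {B' A' : B} {h' : B' ⟶ B₀} {f' : B' ⟶ A'} {h : A' ⟶ A₀}
    (sq : IsPullback h' f' f h) {T : p.Fiber B'} {W : p.Fiber A'}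
    {c : fiberInclusion.obj T ⟶ fiberInclusion.obj W} (hc : p.IsStronglyCartesian f' c)
    {a : fiberInclusion.obj T ⟶ fiberInclusion.obj N} (ha : p.IsHomLift h' a) :
    ∃! n : fiberInclusion.obj W ⟶ fiberInclusion.obj (R.obj N), p.IsHomLift h n ∧
      ∃ t : fiberInclusion.obj T ⟶ fiberInclusion.obj ((reindex p f).obj (R.obj N)),
        p.IsHomLift h' t ∧ t ≫ cartMap f (R.obj N) = c ≫ n ∧
          t ≫ fiberInclusion.map (adj.counit.app N) = a := by
  have hf' : D f' := MorphismProperty.of_isPullback sq hf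
  have := hp.isLeftAdjoint f' hf'
  let R' := (reindex p f').rightAdjoint
  let adj' : reindex p f' ⊣ R' := Adjunction.ofIsLeftAdjoint _
  let α : TwoSquare (reindex p h) (reindex p f) (reindex p f') (reindex p h') :=
    TwoSquare.mk _ _ _ _ (reindexSquare p f' h h' f sq.w.symm).hom
  -- The Beck–Chevalley comparison at `N`. Its invertibility reduces maps into `h^* ∏_f N` to
  -- transposition along `f'`.
  let β : (reindex p h).obj (R.obj N) ⟶ R'.obj ((reindex p h').obj N) :=
    (mateEquiv adj adj' α).natTrans.app N
  have hβ : IsIso β := by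
    have := hp.beckChevalley f' h h' f sq hf hf' R R' adj adj'
    exact inferInstanceAs (IsIso ((mateEquiv adj adj' α).natTrans.app N))
  have hcounit : (reindex p f').map β ≫ adj'.counit.app ((reindex p h').obj N) =
      (reindexSquare p f' h h' f sq.w.symm).hom.app (R.obj N) ≫
        (reindex p h').map (adj.counit.app N) := mateEquiv_counit adj adj' α N
  obtain ⟨k, rfl⟩ := exists_vertical (cartMap_isCartesian f' W) hc.toIsHomLift
  have hk : IsIso k := isIso_of_isStronglyCartesian (cartMap_isCartesian f' W) hc rfl
  -- the transpose of a vertical map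
  have htrans : ∀ n₀ : W ⟶ (reindex p h).obj (R.obj N),
      (adj'.homEquiv _ _).symm (n₀ ≫ β) = (reindex p f').map n₀ ≫
        (reindexSquare p f' h h' f sq.w.symm).hom.app (R.obj N) ≫
          (reindex p h').map (adj.counit.app N) := by
    intro n₀
    rw [Adjunction.homEquiv_counit, CategoryTheory.Functor.map_comp, Category.assoc, hcounit]
  -- The map over `h'` that `n₀` induces between the pullbacks along `f`. Since `cartMap f` is
  -- cartesian, the `t` in the statement can only be this map.
  let τ : (W ⟶ (reindex p h).obj (R.obj N)) →
      (fiberInclusion.obj T ⟶ fiberInclusion.obj ((reindex p f).obj (R.obj N))) := fun n₀ =>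
    fiberInclusion.map (k ≫ (reindex p f').map n₀ ≫
        (reindexSquare p f' h h' f sq.w.symm).hom.app (R.obj N)) ≫
      cartMap h' ((reindex p f).obj (R.obj N))
  have hτ : ∀ n₀, p.IsHomLift h' (τ n₀) := fun n₀ =>
    isHomLift_comp (Category.id_comp h') (map_isHomLift_id _) (cartMap_isHomLift h' _)
  have hτ₁ : ∀ n₀, τ n₀ ≫ cartMap f (R.obj N) = (fiberInclusion.map k ≫ cartMap f' W) ≫
      fiberInclusion.map n₀ ≫ cartMap h (R.obj N) := by
    intro n₀
    simp only [τ, CategoryTheory.Functor.map_comp, Category.assoc]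
    erw [map_reindexSquare_hom_app_comp_cartMap, map_reindex_map_comp_cartMap_assoc]
  have hτ₂ : ∀ n₀, τ n₀ ≫ fiberInclusion.map (adj.counit.app N) =
      fiberInclusion.map (k ≫ (adj'.homEquiv _ _).symm (n₀ ≫ β)) ≫ cartMap h' N := by
    intro n₀
    rw [htrans]
    simp only [τ, CategoryTheory.Functor.map_comp, Category.assoc]
    erw [map_reindex_map_comp_cartMap]
  obtain ⟨a', rfl⟩ := exists_vertical (cartMap_isCartesian h' N) ha
  -- The witness is the transpose of `a` along `f'`, after replacing `T` by `f'^* W` through `k`,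
  -- carried back along the inverse of `β`.
  refine ⟨fiberInclusion.map (adj'.homEquiv _ _ (inv k ≫ a') ≫ inv β) ≫ cartMap h (R.obj N),
    ⟨isHomLift_comp (Category.id_comp h) (map_isHomLift_id _) (cartMap_isHomLift h _),
      τ _, hτ _, hτ₁ _, ?_⟩, ?_⟩
  · rw [hτ₂, Category.assoc, IsIso.inv_hom_id, Category.comp_id, Equiv.symm_apply_apply,
      IsIso.hom_inv_id_assoc]
  · rintro n ⟨hn, t, ht, ht₁, ht₂⟩
    obtain ⟨n₀, rfl⟩ := exists_vertical (cartMap_isCartesian h (R.obj N)) hn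
    obtain rfl : t = τ n₀ := IsStronglyCartesian.hom_ext (cartMap_isCartesian f (R.obj N)) ht (hτ _)
      (by rw [ht₁, hτ₁])
    rw [hτ₂] at ht₂
    have := vertical_ext (cartMap_isCartesian h' N) ht₂
    rw [← this, IsIso.inv_hom_id_assoc, Equiv.apply_symm_apply, Category.assoc, IsIso.hom_inv_id,
      Category.comp_id]

end

/-! ### Dependent products by their universal property -/

section

variable {C : Type u₁} [Category.{v₁} C]

/-- `r : R ⟶ A` with `ev : S ⟶ X`, where `S` is the pullback of `R` along `f`, is a product of
`g : X ⟶ Y` along `f : Y ⟶ A`. -/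
structure IsPi {A Y X R S : C} (f : Y ⟶ A) (g : X ⟶ Y) (r : R ⟶ A) (k : S ⟶ R) (l : S ⟶ Y)
    (ev : S ⟶ X) : Prop where
  isPullback : IsPullback l k f r
  ev_comp : ev ≫ g = l
  existsUnique : ∀ {W T : C} {w : W ⟶ A} {a : T ⟶ Y} {b : T ⟶ W} (_ : IsPullback a b f w)
    {m : T ⟶ X} (_ : m ≫ g = a),
    ∃! n : W ⟶ R, n ≫ r = w ∧ ∃ t : T ⟶ S, t ≫ k = b ≫ n ∧ t ≫ ev = m

/-- It suffices to check the universal property for one representative of each pullback. -/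
lemma IsPi.mk' {A Y X R S : C} {f : Y ⟶ A} {g : X ⟶ Y} {r : R ⟶ A} {k : S ⟶ R} {l : S ⟶ Y}
    {ev : S ⟶ X} (sq : IsPullback l k f r) (e : ev ≫ g = l)
    (h : ∀ {W : C} (w : W ⟶ A), ∃ (T : C) (a : T ⟶ Y) (b : T ⟶ W), IsPullback a b f w ∧
      ∀ m : T ⟶ X, m ≫ g = a →
        ∃! n : W ⟶ R, n ≫ r = w ∧ ∃ t : T ⟶ S, t ≫ k = b ≫ n ∧ t ≫ ev = m) :
    IsPi f g r k l ev := by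
  refine ⟨sq, e, fun {W T w a b} sq' {m} em => ?_⟩
  obtain ⟨T', a', b', sq'', H⟩ := h w
  let i : T' ≅ T := sq''.isoIsPullback _ _ sq'
  have hi₁ : i.hom ≫ a = a' := IsPullback.isoIsPullback_hom_fst _ _ sq'' sq'
  have hi₂ : i.hom ≫ b = b' := IsPullback.isoIsPullback_hom_snd _ _ sq'' sq'
  obtain ⟨n, ⟨hn, t, ht₁, ht₂⟩, hu⟩ := H (i.hom ≫ m) (by rw [Category.assoc, em, hi₁])
  refine ⟨n, ⟨hn, i.inv ≫ t, ?_, ?_⟩, ?_⟩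
  · rw [Category.assoc, ht₁, ← hi₂, Category.assoc, Iso.inv_hom_id_assoc]
  · rw [Category.assoc, ht₂, Iso.inv_hom_id_assoc]
  · rintro n' ⟨hn', t', ht'₁, ht'₂⟩
    refine hu n' ⟨hn', i.hom ≫ t', ?_, ?_⟩
    · rw [Category.assoc, ht'₁, ← hi₂, Category.assoc]
    · rw [Category.assoc, ht'₂]

/-- Passes from a terminal object of a comma category, tied to chosen pullbacks, to a universal
property that holds for every representative of the pullback. The isomorphism `i` compares the two.
-/
lemma HasPiTypes.exists_isPi {D : MorphismProperty C} (hD : HasPiTypes D) {A Y X : C} {f : Y ⟶ A}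
    {g : X ⟶ Y} (hf : D f) (hg : D g) :
    ∃ (R S : C) (r : R ⟶ A) (k : S ⟶ R) (l : S ⟶ Y) (ev : S ⟶ X),
      D r ∧ IsPi f g r k l ev := by
  obtain ⟨_, P, hP, ⟨hT⟩⟩ := hD f g hf hg
  refine ⟨_, _, P.left.hom, pullback.fst P.left.hom f, pullback.snd P.left.hom f, P.hom.left, hP,
    (IsPullback.of_hasPullback P.left.hom f).flip, Over.w P.hom, ?_⟩
  intro W T w a b sq m em
  let i : T ≅ pullback w f := sq.flip.isoPullback
  have hi₁ : i.hom ≫ pullback.fst w f = b := sq.flip.isoPullback_hom_fst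
  have hi₂ : i.hom ≫ pullback.snd w f = a := sq.flip.isoPullback_hom_snd
  have hi₂' : i.inv ≫ a = pullback.snd w f := by rw [← hi₂, Iso.inv_hom_id_assoc]
  let m' : (Over.pullback f).obj (Over.mk w) ⟶ Over.mk g :=
    Over.homMk (i.inv ≫ m) (by
      change (i.inv ≫ m) ≫ g = pullback.snd w f
      rw [Category.assoc, em, hi₂'])
  let Q : CostructuredArrow (Over.pullback f) (Over.mk g) := CostructuredArrow.mk m'
  have hfst : ∀ φ : Over.mk w ⟶ P.left, ((Over.pullback f).map φ).left ≫
      pullback.fst P.left.hom f = pullback.fst w f ≫ φ.left :=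
    fun φ => pullback.lift_fst _ _ _
  have hsnd : ∀ φ : Over.mk w ⟶ P.left, ((Over.pullback f).map φ).left ≫
      pullback.snd P.left.hom f = pullback.snd w f :=
    fun φ => pullback.lift_snd _ _ _
  let φ := hT.from Q
  have hφ : (Over.pullback f).map φ.left ≫ P.hom = m' := CostructuredArrow.w φ
  have hφ' : ((Over.pullback f).map φ.left).left ≫ P.hom.left = i.inv ≫ m :=
    congrArg CommaMorphism.left hφ
  refine ⟨φ.left.left, ⟨Over.w φ.left, i.hom ≫ ((Over.pullback f).map φ.left).left, ?_, ?_⟩, ?_⟩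
  · rw [Category.assoc, hfst, ← Category.assoc, hi₁]
  · rw [Category.assoc, hφ', Iso.hom_inv_id_assoc]
  · rintro n ⟨hn, t, ht₁, ht₂⟩
    let ν : Over.mk w ⟶ P.left := Over.homMk n hn
    have ht : i.inv ≫ t = ((Over.pullback f).map ν).left := by
      apply pullback.hom_ext
      · rw [hfst, Category.assoc, ht₁, ← hi₁, Category.assoc, Iso.inv_hom_id_assoc]
        rfl
      · rw [hsnd, ← show P.hom.left ≫ g = pullback.snd P.left.hom f from Over.w P.hom]
        have : (i.inv ≫ t) ≫ P.hom.left ≫ g = i.inv ≫ (t ≫ P.hom.left) ≫ g := by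
          simp only [Category.assoc]
        exact this.trans (by rw [ht₂, em, hi₂'])
    let ψ : Q ⟶ P := CostructuredArrow.homMk ν (by
      apply Over.OverMorphism.ext
      change ((Over.pullback f).map ν).left ≫ P.hom.left = i.inv ≫ m
      rw [← ht, Category.assoc, ht₂])
    have := hT.hom_ext ψ φ
    exact congrArg (fun χ => χ.left.left) this

/-- The converse passage: `ev`, transported to the chosen pullback by `i`, is the couniversal arrow.
-/
lemma HasPiTypes.of_exists_isPi {D : MorphismProperty C} [D.HasPullbacks]
    (h : ∀ {A Y X : C} (f : Y ⟶ A) (g : X ⟶ Y), D f → D g →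
      ∃ (R S : C) (r : R ⟶ A) (k : S ⟶ R) (l : S ⟶ Y) (ev : S ⟶ X),
        D r ∧ IsPi f g r k l ev) : HasPiTypes D := by
  intro Y A X f g hf hg
  obtain ⟨R, S, r, k, l, ev, hr, H⟩ := h f g hf hg
  have hf' : HasPullbacksAlong f := fun w =>
    have := MorphismProperty.HasPullbacks.hasPullback w hf
    hasPullback_symmetry f w
  let i : pullback r f ≅ S := H.isPullback.flip.isoPullback.symm
  have hi₁ : i.hom ≫ k = pullback.fst r f := H.isPullback.flip.isoPullback_inv_fst
  have hi₂ : i.hom ≫ l = pullback.snd r f := H.isPullback.flip.isoPullback_inv_snd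
  let P : CostructuredArrow (Over.pullback f) (Over.mk g) :=
    CostructuredArrow.mk (Y := Over.mk r) (Over.homMk (i.hom ≫ ev) (by
      change (i.hom ≫ ev) ≫ g = pullback.snd r f
      rw [Category.assoc, H.ev_comp, hi₂]))
  have key : ∀ Q : CostructuredArrow (Over.pullback f) (Over.mk g), Nonempty (Unique (Q ⟶ P)) := by
    intro Q
    have hfst : ∀ φ : Q.left ⟶ Over.mk r, ((Over.pullback f).map φ).left ≫
        pullback.fst r f = pullback.fst Q.left.hom f ≫ φ.left :=
      fun φ => pullback.lift_fst _ _ _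
    have hsnd : ∀ φ : Q.left ⟶ Over.mk r, ((Over.pullback f).map φ).left ≫
        pullback.snd r f = pullback.snd Q.left.hom f :=
      fun φ => pullback.lift_snd _ _ _
    have hQ : Q.hom.left ≫ g = pullback.snd Q.left.hom f := Over.w Q.hom
    obtain ⟨n, ⟨hn, t, ht₁, ht₂⟩, hu⟩ :=
      H.existsUnique (IsPullback.of_hasPullback Q.left.hom f).flip hQ
    let ν : Q.left ⟶ P.left := Over.homMk n hn
    refine ⟨⟨⟨CostructuredArrow.homMk ν ?_⟩, ?_⟩⟩
    · apply Over.OverMorphism.ext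
      change ((Over.pullback f).map ν).left ≫ i.hom ≫ ev = Q.hom.left
      have : ((Over.pullback f).map ν).left ≫ i.hom = t := by
        apply H.isPullback.flip.hom_ext
        · rw [Category.assoc, hi₁, hfst, ht₁]
          rfl
        · rw [Category.assoc, hi₂, hsnd, ← H.ev_comp, ← Category.assoc, ht₂, hQ]
      rw [← Category.assoc, this, ht₂]
    · intro φ
      apply CostructuredArrow.hom_ext
      apply Over.OverMorphism.ext
      refine hu φ.left.left ⟨Over.w φ.left, ((Over.pullback f).map φ.left).left ≫ i.hom, ?_, ?_⟩
      · rw [Category.assoc, hi₁, hfst]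
      · rw [Category.assoc]
        exact congrArg CommaMorphism.left (CostructuredArrow.w φ)
  exact ⟨hf', P, hr, ⟨IsTerminal.ofUniqueHom (fun Q => (key Q).some.default)
    (fun Q φ => (key Q).some.uniq φ)⟩⟩

/-- Products along a composite are iterated products. -/
lemma IsPi.comp {A Y Z X R₁ S₁ R₂ S₂ S : C} {f₁ : Z ⟶ Y} {f₂ : Y ⟶ A} {g : X ⟶ Z}
    {r₁ : R₁ ⟶ Y} {k₁ : S₁ ⟶ R₁} {l₁ : S₁ ⟶ Z} {ev₁ : S₁ ⟶ X} {r₂ : R₂ ⟶ A} {k₂ : S₂ ⟶ R₂}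
    {l₂ : S₂ ⟶ Y} {ev₂ : S₂ ⟶ R₁} (h₁ : IsPi f₁ g r₁ k₁ l₁ ev₁) (h₂ : IsPi f₂ r₁ r₂ k₂ l₂ ev₂)
    {d : S ⟶ S₁} {k : S ⟶ S₂} (sq : IsPullback d k k₁ ev₂)
    (hf₁ : ∀ {W : C} (w : W ⟶ Y), HasPullback f₁ w)
    (hf₂ : ∀ {W : C} (w : W ⟶ A), HasPullback f₂ w) :
    IsPi (f₁ ≫ f₂) g r₂ (k ≫ k₂) (d ≫ l₁) (d ≫ ev₁) := by
  have sq₁ := sq.paste_horiz h₁.isPullback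
  rw [h₂.ev_comp] at sq₁
  refine IsPi.mk' (sq₁.paste_vert h₂.isPullback) ?_ fun {W} w => ?_
  · rw [Category.assoc, h₁.ev_comp]
  · have := hf₂ w
    have sq₂ := IsPullback.of_hasPullback f₂ w
    set a₂ := pullback.fst f₂ w
    set b₂ := pullback.snd f₂ w
    have := hf₁ a₂
    have sq₃ := IsPullback.of_hasPullback f₁ a₂
    set a₁ := pullback.fst f₁ a₂
    set b₁ := pullback.snd f₁ a₂
    refine ⟨_, a₁, b₁ ≫ b₂, sq₃.paste_vert sq₂, fun m em => ?_⟩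
    -- Transpose `m` along `f₁`, and the result along `f₂`.
    obtain ⟨n₁, ⟨hn₁, t₁, ht₁, ht₁'⟩, hu₁⟩ := h₁.existsUnique sq₃ em
    obtain ⟨n₂, ⟨hn₂, t₂, ht₂, ht₂'⟩, hu₂⟩ := h₂.existsUnique sq₂ hn₁
    refine ⟨n₂, ⟨hn₂, sq.lift t₁ (b₁ ≫ t₂) ?_, ?_, ?_⟩, ?_⟩
    · rw [ht₁, Category.assoc, ht₂']
    · rw [← Category.assoc, sq.lift_snd, Category.assoc, ht₂, Category.assoc]
    · rw [← Category.assoc, sq.lift_fst, ht₁']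
    · rintro n ⟨hn, t, ht, ht'⟩
      apply hu₂
      -- Here `t'` is the pullback of the competitor `n` along `f₂`. By uniqueness for the first
      -- product, `t' ≫ ev₂` is `n₁`, so uniqueness for the second applies to `n`.
      obtain ⟨t', ht'₁, ht'₂⟩ : ∃ t' : pullback f₂ w ⟶ S₂, t' ≫ l₂ = a₂ ∧ t' ≫ k₂ = b₂ ≫ n :=
        ⟨h₂.isPullback.lift a₂ (b₂ ≫ n) (by rw [Category.assoc, hn, sq₂.w]),
          h₂.isPullback.lift_fst _ _ _, h₂.isPullback.lift_snd _ _ _⟩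
      have htk : t ≫ k = b₁ ≫ t' := by
        apply h₂.isPullback.hom_ext
        · rw [Category.assoc, ← sq₁.w, Category.assoc b₁, ht'₁, ← sq₃.w, ← em, ← ht', ← h₁.ev_comp]
          simp only [Category.assoc]
        · rw [Category.assoc, ht, Category.assoc, Category.assoc, ht'₂]
      refine ⟨hn, t', ht'₂, hu₁ _ ⟨?_, t ≫ d, ?_, ?_⟩⟩
      · rw [Category.assoc, h₂.ev_comp, ht'₁]
      · rw [Category.assoc, sq.w, ← Category.assoc, htk, Category.assoc]
      · rw [Category.assoc, ht']

end

/-! ### Quasifibred products as products along vertical maps -/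

section

variable {B : Type u₁} [Category.{v₁} B] {E : Type u₂} [Category.{v₂} E]
variable {p : E ⥤ B} [p.IsFibered] {D : MorphismProperty B}
  {ℰ : ∀ I : B, MorphismProperty (p.Fiber I)}

/-- The two maps `t` have different codomains until the sections are identified; comparing maps into
`P` in `E` avoids transport. -/
lemma SectionPair.ext_of_toTotal {I : B} {X : p.Fiber I} {Q : B} {q : Q ⟶ I} {P : p.Fiber Q}
    {π : P ⟶ (reindex p q).obj X} {I' : B} {h : I' ⟶ I} {W : p.Fiber I'}
    {w : W ⟶ (reindex p h).obj X} {x y : SectionPair p q π h w} (hs : x.s = y.s)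
    (ht : x.toTotal = y.toTotal) : x = y := by
  obtain ⟨s, hs₁, t, ht₁⟩ := x
  obtain ⟨s', hs₁', t', ht₁'⟩ := y
  obtain rfl : s = s' := hs
  obtain rfl : t = t' := vertical_ext (cartMap_isCartesian s P) ht
  rfl

lemma SectionPair.toTotal_isHomLift {I : B} {X : p.Fiber I} {Q : B} {q : Q ⟶ I} {P : p.Fiber Q}
    {π : P ⟶ (reindex p q).obj X} {I' : B} {h : I' ⟶ I} {W : p.Fiber I'}
    {w : W ⟶ (reindex p h).obj X} (x : SectionPair p q π h w) : p.IsHomLift x.s x.toTotal :=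
  isHomLift_comp (Category.id_comp _) (map_isHomLift_id x.t) (cartMap_isHomLift x.s P)

lemma SectionPair.toTotal_comp {I : B} {X : p.Fiber I} {Q : B} {q : Q ⟶ I} {P : p.Fiber Q}
    {π : P ⟶ (reindex p q).obj X} {I' : B} {h : I' ⟶ I} {W : p.Fiber I'}
    {w : W ⟶ (reindex p h).obj X} (x : SectionPair p q π h w) :
    x.toTotal ≫ fiberInclusion.map π ≫ cartMap q X = fiberInclusion.map w ≫ cartMap h X := by
  have h₁ := map_reindexComp_hom_app_comp_cartMap x.s q h x.s_comp X
  have h₂ := map_reindex_map_comp_cartMap_assoc x.s π (cartMap q X)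
  have h₃ := congrArg (fun k => fiberInclusion.map k ≫ cartMap h X) x.t_comp
  simp only [CategoryTheory.Functor.map_comp, Category.assoc] at h₃
  rw [h₁] at h₃
  refine Eq.trans ?_ h₃
  refine Eq.trans ?_ (congrArg (fiberInclusion.map x.t ≫ ·) h₂.symm)
  exact Category.assoc _ _ _

/-- The pair consisting of the identity section and the identity map. -/
lemma exists_sectionPair_id {I : B} {X : p.Fiber I} {Q : B} (q : Q ⟶ I) {P : p.Fiber Q}
    (π : P ⟶ (reindex p q).obj X) :
    ∃ x : SectionPair p q π q π, x.s = 𝟙 Q ∧ x.toTotal = 𝟙 (fiberInclusion.obj P) := by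
  obtain ⟨t, ht⟩ := exists_vertical (cartMap_isCartesian (𝟙 Q) P) (map_isHomLift_id (𝟙 P))
  refine ⟨⟨𝟙 Q, Category.id_comp q, t, ?_⟩, rfl, ?_⟩
  · apply vertical_ext (cartMap_isCartesian q X)
    rw [CategoryTheory.Functor.map_comp, CategoryTheory.Functor.map_comp, Category.assoc,
      Category.assoc, map_reindexComp_hom_app_comp_cartMap, map_reindex_map_comp_cartMap_assoc,
      ← Category.assoc, ht, CategoryTheory.Functor.map_id, Category.id_comp]
  · exact ht.trans (CategoryTheory.Functor.map_id _ _)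

/-- Quasifibred products are products along vertical display maps in the total category. -/
lemma QuasifibredPi.exists_isPi {ℰ' : ∀ I : B, MorphismProperty (p.Fiber I)}
    (hℰ : IsFibredDisplayMapClass p ℰ) {J K : B} {Y X : p.Fiber J}
    {φ : Y ⟶ X} (hφ : ℰ J φ) {k : K ⟶ J} {Z : p.Fiber K} {ψ : Z ⟶ (reindex p k).obj Y}
    (Φ : QuasifibredPi p D ℰ' ψ ((reindex p k).map φ)) :
    ∃ (S : E) (kS : S ⟶ fiberInclusion.obj Φ.P) (l : S ⟶ fiberInclusion.obj Y)
      (ev : S ⟶ fiberInclusion.obj Z),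
      IsPi (fiberInclusion.map φ) (fiberInclusion.map ψ ≫ cartMap k Y)
        (fiberInclusion.map Φ.π ≫ cartMap Φ.q _ ≫ cartMap k X) kS l ev := by
  have hφk := hℰ.map_mem k φ hφ
  have hφq := hℰ.map_mem Φ.q _ hφk
  have hcQ := hℰ.isDisplayMapClass Φ.Q
  have := MorphismProperty.HasPullbacks.hasPullback Φ.π hφq
  have sqS := IsPullback.of_hasPullback ((reindex p Φ.q).map ((reindex p k).map φ)) Φ.π
  set aS := pullback.fst ((reindex p Φ.q).map ((reindex p k).map φ)) Φ.π
  set bS := pullback.snd ((reindex p Φ.q).map ((reindex p k).map φ)) Φ.π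
  -- As in the Yoneda lemma, evaluation corresponds to the universal pair formed from `π` itself,
  -- with `h = q`.
  obtain ⟨x, hx, hx'⟩ := exists_sectionPair_id Φ.q Φ.π
  let evS := (Φ.bij Φ.q Φ.π aS bS sqS.flip).symm x
  have hevS : Φ.bij Φ.q Φ.π aS bS sqS.flip evS = x := Equiv.apply_symm_apply _ _
  have sqE : IsPullback (fiberInclusion.map aS ≫ cartMap Φ.q _ ≫ cartMap k Y)
      (fiberInclusion.map bS) (fiberInclusion.map φ)
      (fiberInclusion.map Φ.π ≫ cartMap Φ.q _ ≫ cartMap k X) :=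
    (hℰ.isPullback_map hφq sqS).paste_horiz ((isPullback_reindex_map Φ.q _).paste_horiz
      (isPullback_reindex_map k φ))
  have hev : (fiberInclusion.map evS.1 ≫ cartMap Φ.q Z) ≫ fiberInclusion.map ψ ≫ cartMap k Y =
      fiberInclusion.map aS ≫ cartMap Φ.q _ ≫ cartMap k Y := by
    rw [Category.assoc, ← map_reindex_map_comp_cartMap_assoc, ← Category.assoc,
      ← CategoryTheory.Functor.map_comp, evS.2]
  refine ⟨_, fiberInclusion.map bS, _, fiberInclusion.map evS.1 ≫ cartMap Φ.q Z,
    IsPi.mk' sqE hev fun {W} w => ?_⟩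
  obtain ⟨I', W, rfl⟩ := exists_fiber_obj p W
  obtain ⟨h, w₀, rfl⟩ := exists_factorization w
  have hφh := hℰ.map_mem h φ hφ
  have hcI := hℰ.isDisplayMapClass I'
  have := MorphismProperty.HasPullbacks.hasPullback w₀ hφh
  have sqT := IsPullback.of_hasPullback ((reindex p h).map φ) w₀
  set a₀ := pullback.fst ((reindex p h).map φ) w₀
  set b₀ := pullback.snd ((reindex p h).map φ) w₀
  refine ⟨_, _, _, (hℰ.isPullback_map hφh sqT).paste_horiz (isPullback_reindex_map h φ), ?_⟩
  intro m em
  obtain ⟨m₀, hm⟩ := exists_isHomLift_fiber m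
  have hg : p.IsHomLift k (fiberInclusion.map ψ ≫ cartMap k Y) :=
    isHomLift_comp (Category.id_comp k) (map_isHomLift_id ψ) (cartMap_isHomLift k Y)
  -- The map `m` lies over some `m₀`, and `m ≫ g = a` forces `w` to lie over `m₀ ≫ k`. Hence `m` is
  -- a test map for the bijection of the product at `m₀`, up to the isomorphisms `e₁`.
  obtain rfl : m₀ ≫ k = h := isHomLift_unique (isHomLift_comp rfl hm hg)
    (em ▸ isHomLift_comp (Category.id_comp _) (map_isHomLift_id a₀) (cartMap_isHomLift _ Y))
  -- the data over `m₀`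
  obtain ⟨e₁, hi, he₁, hn⟩ : ∃ e : ∀ A : p.Fiber J, (reindex p (m₀ ≫ k)).obj A ⟶
      (reindex p m₀).obj ((reindex p k).obj A), (∀ A, IsIso (e A)) ∧
      (∀ A, fiberInclusion.map (e A) ≫ cartMap m₀ _ ≫ cartMap k A = cartMap (m₀ ≫ k) A) ∧
      (e Y ≫ (reindex p m₀).map ((reindex p k).map φ) = (reindex p (m₀ ≫ k)).map φ ≫ e X) := by
    refine ⟨fun A => (reindexComp p m₀ k (m₀ ≫ k) rfl).inv.app A, fun A => inferInstance,
      fun A => ?_, ((reindexComp p m₀ k (m₀ ≫ k) rfl).inv.naturality φ).symm⟩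
    rw [← map_reindexComp_hom_app_comp_cartMap m₀ k _ rfl A, ← Category.assoc,
      ← CategoryTheory.Functor.map_comp, Iso.inv_hom_id_app, CategoryTheory.Functor.map_id,
      Category.id_comp]
  have := hi X
  have := hi Y
  have sq₁ : IsPullback b₀ (a₀ ≫ e₁ Y) (w₀ ≫ e₁ X) ((reindex p m₀).map ((reindex p k).map φ)) :=
    (sqT.paste_horiz (IsPullback.of_horiz_isIso ⟨hn⟩)).flip
  have hw₁ : fiberInclusion.map (w₀ ≫ e₁ X) ≫ cartMap m₀ _ ≫ cartMap k X =
      fiberInclusion.map w₀ ≫ cartMap (m₀ ≫ k) X := by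
    rw [CategoryTheory.Functor.map_comp, Category.assoc, he₁]
  have ha₁ : fiberInclusion.map (a₀ ≫ e₁ Y) ≫ cartMap m₀ _ ≫ cartMap k Y =
      fiberInclusion.map a₀ ≫ cartMap (m₀ ≫ k) Y := by
    rw [CategoryTheory.Functor.map_comp, Category.assoc, he₁]
  have hvert : ∀ {m' : fiberInclusion.obj (pullback ((reindex p (m₀ ≫ k)).map φ) w₀) ⟶
      fiberInclusion.obj Z}, p.IsHomLift m₀ m' →
      m' ≫ fiberInclusion.map ψ ≫ cartMap k Y = fiberInclusion.map a₀ ≫ cartMap (m₀ ≫ k) Y →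
      ∃ m₁ : {m₁ : pullback ((reindex p (m₀ ≫ k)).map φ) w₀ ⟶ (reindex p m₀).obj Z //
        m₁ ≫ (reindex p m₀).map ψ = a₀ ≫ e₁ Y}, fiberInclusion.map m₁.1 ≫ cartMap m₀ Z = m' := by
    intro m' hm' em'
    obtain ⟨m₁, rfl⟩ := exists_vertical (cartMap_isCartesian m₀ Z) hm'
    refine ⟨⟨m₁, ?_⟩, rfl⟩
    apply vertical_ext (isStronglyCartesian_comp rfl (cartMap_isCartesian m₀ _)
      (cartMap_isCartesian k Y))
    rw [CategoryTheory.Functor.map_comp, Category.assoc, map_reindex_map_comp_cartMap_assoc, ha₁,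
      ← em', Category.assoc]
  -- Naturality along `s`, starting from the universal pair: whenever evaluating at `n` yields `m₁`,
  -- the pair attached to `m₁` is `(s, n)`.
  have key : ∀ (m₁ : {m₁ : pullback ((reindex p (m₀ ≫ k)).map φ) w₀ ⟶ (reindex p m₀).obj Z //
        m₁ ≫ (reindex p m₀).map ψ = a₀ ≫ e₁ Y}) (s : I' ⟶ Φ.Q)
      (n : fiberInclusion.obj W ⟶ fiberInclusion.obj Φ.P) (_ : p.IsHomLift s n) (_ : s ≫ Φ.q = m₀)
      (_ : n ≫ fiberInclusion.map Φ.π ≫ cartMap Φ.q _ ≫ cartMap k X =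
        fiberInclusion.map w₀ ≫ cartMap (m₀ ≫ k) X)
      (t : fiberInclusion.obj (pullback ((reindex p (m₀ ≫ k)).map φ) w₀) ⟶ _)
      (_ : t ≫ fiberInclusion.map bS = fiberInclusion.map b₀ ≫ n)
      (_ : t ≫ fiberInclusion.map evS.1 ≫ cartMap Φ.q Z = fiberInclusion.map m₁.1 ≫ cartMap m₀ Z),
      (Φ.bij m₀ _ _ _ sq₁ m₁).s = s ∧ (Φ.bij m₀ _ _ _ sq₁ m₁).toTotal = n := by
    intro m₁ s n hn hs hnr t ht₁ ht₂
    have ht : p.IsHomLift s t := isHomLift_of_comp_map bS (ht₁ ▸ isHomLift_comp (Category.id_comp s) (map_isHomLift_id b₀) hn)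
    have h₁ : n ≫ fiberInclusion.map Φ.π ≫ cartMap Φ.q _ =
        fiberInclusion.map (w₀ ≫ e₁ X) ≫ cartMap m₀ _ := by
      refine IsStronglyCartesian.hom_ext (cartMap_isCartesian k X)
        (isHomLift_comp hs hn (isHomLift_comp (Category.id_comp _) (map_isHomLift_id _)
          (cartMap_isHomLift _ _)))
        (isHomLift_comp (Category.id_comp _) (map_isHomLift_id _) (cartMap_isHomLift _ _)) ?_
      simp only [Category.assoc]
      rw [hnr, hw₁]
    have h₂ : t ≫ fiberInclusion.map aS ≫ cartMap Φ.q _ =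
        fiberInclusion.map (a₀ ≫ e₁ Y) ≫ cartMap m₀ _ := by
      refine IsStronglyCartesian.hom_ext (cartMap_isCartesian k Y)
        (isHomLift_comp hs ht (isHomLift_comp (Category.id_comp _) (map_isHomLift_id _)
          (cartMap_isHomLift _ _)))
        (isHomLift_comp (Category.id_comp _) (map_isHomLift_id _) (cartMap_isHomLift _ _)) ?_
      have := congrArg (· ≫ fiberInclusion.map ψ ≫ cartMap k Y) ht₂
      simp only [Category.assoc] at hev this ⊢
      rw [← hev, ← m₁.2, CategoryTheory.Functor.map_comp, Category.assoc,
        map_reindex_map_comp_cartMap_assoc, this]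
    obtain ⟨h₃, h₄⟩ := Φ.naturality Φ.q s m₀ hs Φ.π aS bS sqS.flip _ _ b₀ sq₁ n hn h₁ t ht ht₁ h₂
      evS m₁ ht₂
    rw [hevS] at h₃ h₄
    rw [h₃, h₄, hx, hx', Category.comp_id, Category.comp_id]
    exact ⟨rfl, rfl⟩
  obtain ⟨m₁, hm₁⟩ := hvert hm em
  have hr : (Φ.bij m₀ _ _ _ sq₁ m₁).toTotal ≫ fiberInclusion.map Φ.π ≫ cartMap Φ.q _ ≫
      cartMap k X = fiberInclusion.map w₀ ≫ cartMap (m₀ ≫ k) X := by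
    have := congrArg (· ≫ cartMap k X) (Φ.bij m₀ _ _ _ sq₁ m₁).toTotal_comp
    simp only [Category.assoc] at this
    rw [this, hw₁]
  refine ⟨(Φ.bij m₀ _ _ _ sq₁ m₁).toTotal, ⟨hr, ?_⟩, ?_⟩
  · have hn := (Φ.bij m₀ _ _ _ sq₁ m₁).toTotal_isHomLift
    have hs := (Φ.bij m₀ _ _ _ sq₁ m₁).s_comp
    have hcomm : (fiberInclusion.map a₀ ≫ cartMap (m₀ ≫ k) Y) ≫ fiberInclusion.map φ =
        (fiberInclusion.map b₀ ≫ (Φ.bij m₀ _ _ _ sq₁ m₁).toTotal) ≫ fiberInclusion.map Φ.π ≫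
          cartMap Φ.q _ ≫ cartMap k X := by
      rw [Category.assoc (fiberInclusion.map b₀), hr]
      exact ((hℰ.isPullback_map hφh sqT).paste_horiz (isPullback_reindex_map _ φ)).w
    have ht₁ := sqE.lift_snd _ _ hcomm
    have ht₂ := sqE.lift_fst _ _ hcomm
    set t := sqE.lift _ _ hcomm
    have ht : p.IsHomLift (Φ.bij m₀ _ _ _ sq₁ m₁).s t :=
      isHomLift_of_comp_map bS
        (ht₁ ▸ isHomLift_comp (Category.id_comp _) (map_isHomLift_id b₀) hn)
    refine ⟨t, ht₁, ?_⟩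
    -- Let `m₂` be the result of evaluating at the pair of `m₁`. By `key` it has the same pair as
    -- `m₁`, so injectivity of the bijection gives `m₂ = m₁`.
    obtain ⟨m₂, hm₂⟩ := hvert (m' := t ≫ fiberInclusion.map evS.1 ≫ cartMap Φ.q Z)
      (isHomLift_comp hs ht (isHomLift_comp (Category.id_comp _) (map_isHomLift_id _)
        (cartMap_isHomLift _ _)))
      (by rw [Category.assoc, hev, ht₂])
    obtain ⟨h₁, h₂⟩ := key m₂ _ _ hn hs hr t ht₁ hm₂.symm
    have := (Φ.bij m₀ _ _ _ sq₁).injective (SectionPair.ext_of_toTotal h₁ h₂)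
    rw [← hm₂, this, hm₁]
  · rintro n ⟨hn, t, ht₁, ht₂⟩
    obtain ⟨s, hs⟩ := exists_isHomLift_fiber n
    have ht : p.IsHomLift s t := isHomLift_of_comp_map bS (ht₁ ▸ isHomLift_comp (Category.id_comp s) (map_isHomLift_id b₀) hs)
    have hsq : s ≫ Φ.q = m₀ := isHomLift_unique (isHomLift_comp rfl ht (isHomLift_comp
      (Category.id_comp _) (map_isHomLift_id evS.1) (cartMap_isHomLift _ _))) (ht₂ ▸ hm)
    exact (key m₁ s n hs hsq hn t ht₁ (ht₂.trans hm₁.symm)).2.symm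

end

/-! ### Products along cartesian maps and `Π`-types of glued maps -/

section

variable {B : Type u₁} [Category.{v₁} B] {E : Type u₂} [Category.{v₂} E]
variable {p : E ⥤ B} [p.IsFibered] {D : MorphismProperty B}
  {ℰ : ∀ I : B, MorphismProperty (p.Fiber I)}

lemma HasProductsAlong.of_le {D' : MorphismProperty B} (hp : HasProductsAlong p D) (h : D' ≤ D) :
    HasProductsAlong p D' where
  isLeftAdjoint _ _ f hf := hp.isLeftAdjoint f (h _ hf)
  beckChevalley _ _ _ _ f' h' h'' f sq hf hf' :=
    hp.beckChevalley f' h' h'' f sq (h _ hf) (h _ hf')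

/-- Products of glued maps along cartesian maps over display maps. -/
lemma exists_isPi_cartMap [IsDisplayMapClass D] (hℰ : IsFibredDisplayMapClass p ℰ)
    (hD : HasPiTypes D) (hp : HasProductsAlong p D) (hcl : ClosedUnderProductsAlong p D ℰ)
    {I J K : B} {j : J ⟶ I} (hj : D j) {k : K ⟶ J} (hk : D k) {X : p.Fiber I} {Z : p.Fiber K}
    {ψ : Z ⟶ (reindex p k).obj ((reindex p j).obj X)} (hψ : ℰ K ψ) :
    ∃ (P S : E) (r : P ⟶ fiberInclusion.obj X) (kS : S ⟶ P)
      (l : S ⟶ fiberInclusion.obj ((reindex p j).obj X)) (ev : S ⟶ fiberInclusion.obj Z),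
      gluedMaps p D ℰ r ∧
        IsPi (cartMap j X) (fiberInclusion.map ψ ≫ cartMap k _) r kS l ev := by
  -- The base of the product is the product of `k` along `j`. Over it, `ψ` is reindexed along the
  -- evaluation `ev₀` and then pushed forward along `jR`.
  obtain ⟨R, JR, r₀, jR, l₀, ev₀, hr₀, H₀⟩ := hD.exists_isPi hj hk
  have hjR : D jR := MorphismProperty.of_isPullback H₀.isPullback hj
  have := hp.isLeftAdjoint jR hjR
  let F := (reindex p jR).rightAdjoint
  let adj : reindex p jR ⊣ F := Adjunction.ofIsLeftAdjoint _
  let N₁ := (reindex p ev₀).obj Z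
  let N₂ := (reindex p ev₀).obj ((reindex p k).obj ((reindex p j).obj X))
  let ψ' : N₁ ⟶ N₂ := (reindex p ev₀).map ψ
  have hΨ : ℰ R (F.map ψ') := hcl jR hjR F adj ψ' (hℰ.map_mem ev₀ ψ hψ)
  let XR := (reindex p r₀).obj X
  have hc₁ : p.IsStronglyCartesian l₀ (cartMap ev₀ _ ≫ cartMap k ((reindex p j).obj X)) :=
    isStronglyCartesian_comp H₀.ev_comp (cartMap_isCartesian ev₀ _) (cartMap_isCartesian k _)
  have hc₂ : p.IsStronglyCartesian (l₀ ≫ j)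
      ((cartMap ev₀ _ ≫ cartMap k ((reindex p j).obj X)) ≫ cartMap j X) :=
    isStronglyCartesian_comp rfl hc₁ (cartMap_isCartesian j X)
  -- Both objects are reindexings of `X` along `l₀ ≫ j = jR ≫ r₀`, and `d` compares them. Its
  -- transpose `η` describes the maps that lie over `X`.
  obtain ⟨d, hd⟩ : ∃ d : (reindex p jR).obj XR ⟶ N₂, fiberInclusion.map d ≫
      (cartMap ev₀ _ ≫ cartMap k ((reindex p j).obj X)) ≫ cartMap j X =
        cartMap jR XR ≫ cartMap r₀ X :=
    exists_vertical hc₂ (isHomLift_comp H₀.isPullback.w.symm (cartMap_isHomLift jR XR)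
      (cartMap_isHomLift r₀ X))
  let η : XR ⟶ F.obj N₂ := adj.homEquiv _ _ d
  have hη : (reindex p jR).map η ≫ adj.counit.app N₂ = d := by
    have := (adj.homEquiv _ _).symm_apply_apply d
    rwa [adj.homEquiv_counit] at this
  have hcR := hℰ.isDisplayMapClass R
  have := MorphismProperty.HasPullbacks.hasPullback η hΨ
  -- Pulling `∏ ψ'` back along `η` selects those families of elements of `Z` whose image under `ψ`
  -- is the one prescribed by `X`.
  have sqP := IsPullback.of_hasPullback (F.map ψ') η
  set P₁ := pullback.fst (F.map ψ') η
  set π := pullback.snd (F.map ψ') η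
  have hπ : ℰ R π := MorphismProperty.of_isPullback sqP hΨ
  have sqP' := hℰ.isPullback_map hΨ sqP
  let l : fiberInclusion.obj ((reindex p jR).obj (pullback (F.map ψ') η)) ⟶ _ :=
    fiberInclusion.map ((reindex p jR).map π ≫ d) ≫
      cartMap ev₀ _ ≫ cartMap k ((reindex p j).obj X)
  have hl : p.IsHomLift l₀ l :=
    isHomLift_comp (Category.id_comp _) (map_isHomLift_id _) hc₁.toIsHomLift
  let ev : fiberInclusion.obj ((reindex p jR).obj (pullback (F.map ψ') η)) ⟶ _ :=
    fiberInclusion.map ((reindex p jR).map P₁ ≫ adj.counit.app N₁) ≫ cartMap ev₀ Z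
  have hr : p.IsHomLift r₀ (fiberInclusion.map π ≫ cartMap r₀ X) :=
    isHomLift_comp (Category.id_comp _) (map_isHomLift_id _) (cartMap_isHomLift _ _)
  refine ⟨_, _, fiberInclusion.map π ≫ cartMap r₀ X, cartMap jR _, l, ev,
    (gluedMaps_iff hℰ (cartMap_isCartesian r₀ X) rfl).2 ⟨hr₀, hπ⟩, IsPi.mk' ?_ ?_ ?_⟩
  · refine isPullback_of_isStronglyCartesian H₀.isPullback hl (cartMap_isCartesian jR _)
      (cartMap_isCartesian j X) hr ?_
    simp only [l, CategoryTheory.Functor.map_comp, Category.assoc] at hd ⊢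
    rw [hd, map_reindex_map_comp_cartMap_assoc]
  · have h₁ : ((reindex p jR).map P₁ ≫ adj.counit.app N₁) ≫ ψ' = (reindex p jR).map π ≫ d := by
      rw [Category.assoc, ← hη, ← Category.assoc ((reindex p jR).map π),
        ← CategoryTheory.Functor.map_comp, ← sqP.w, CategoryTheory.Functor.map_comp, Category.assoc]
      congr 1
      exact (adj.counit.naturality ψ').symm
    simp only [l, ev]
    rw [Category.assoc, ← map_reindex_map_comp_cartMap_assoc, ← Category.assoc,
      ← CategoryTheory.Functor.map_comp, h₁]
  intro W w
  obtain ⟨I', W, rfl⟩ := exists_fiber_obj p W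
  obtain ⟨h, hw⟩ := exists_isHomLift_fiber w
  have := MorphismProperty.HasPullbacks.hasPullback h hj
  have sqJ := IsPullback.of_hasPullback j h
  set h' := pullback.fst j h
  set j' := pullback.snd j h
  obtain ⟨a, ha, haw⟩ := IsStronglyCartesian.exists_lift (cartMap_isCartesian j X) sqJ.w
    (isHomLift_comp rfl (cartMap_isHomLift j' W) hw)
  refine ⟨_, a, cartMap j' W, isPullback_of_isStronglyCartesian sqJ ha (cartMap_isCartesian j' W)
    (cartMap_isCartesian j X) hw haw, fun m em => ?_⟩
  obtain ⟨m₀, hm⟩ := exists_isHomLift_fiber m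
  have hm₀ : m₀ ≫ k = h' := isHomLift_unique (isHomLift_comp rfl hm (isHomLift_comp
    (Category.id_comp _) (map_isHomLift_id ψ) (cartMap_isHomLift k _))) (em ▸ ha)
  -- The base component of the transpose comes from the product in the base; the rest is transposed
  -- along `jR` over `σ`.
  obtain ⟨σ, ⟨hσ, τ, hτ₁, hτ₂⟩, huσ⟩ := H₀.existsUnique sqJ hm₀
  have hτ₃ : τ ≫ l₀ = h' := by rw [← H₀.ev_comp, ← Category.assoc, hτ₂, hm₀]
  have sqσ : IsPullback τ j' jR σ :=
    IsPullback.of_right (by rw [hτ₃, hσ]; exact sqJ) hτ₁ H₀.isPullback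
  obtain ⟨m', hm', hm'e⟩ := IsStronglyCartesian.exists_lift (cartMap_isCartesian ev₀ Z) hτ₂ hm
  obtain ⟨w', hw', hw'e⟩ := IsStronglyCartesian.exists_lift (cartMap_isCartesian r₀ X) hσ hw
  obtain ⟨n₁, ⟨hn₁, t₁, ht₁, ht₁c, ht₁e⟩, hu₁⟩ :=
    hp.existsUnique hjR adj N₁ sqσ (cartMap_isCartesian j' W) hm'
  obtain ⟨b', hb', hb'e⟩ := IsStronglyCartesian.exists_lift (cartMap_isCartesian jR XR) hτ₁
    (isHomLift_comp rfl (cartMap_isHomLift j' W) hw')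
  -- Both sides are the transpose of `m' ≫ ψ'`, so they agree and define a map into the pullback
  -- `P`.
  have hn₁w' : n₁ ≫ fiberInclusion.map (F.map ψ') = w' ≫ fiberInclusion.map η := by
    have hm'ψ : p.IsHomLift τ (m' ≫ fiberInclusion.map ψ') :=
      isHomLift_comp (Category.comp_id _) hm' (map_isHomLift_id _)
    refine (hp.existsUnique hjR adj N₂ sqσ (cartMap_isCartesian j' W) hm'ψ).unique
      ⟨isHomLift_comp (Category.comp_id _) hn₁ (map_isHomLift_id _),
        t₁ ≫ fiberInclusion.map ((reindex p jR).map (F.map ψ')),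
        isHomLift_comp (Category.comp_id _) ht₁ (map_isHomLift_id _), ?_, ?_⟩
      ⟨isHomLift_comp (Category.comp_id _) hw' (map_isHomLift_id _),
        b' ≫ fiberInclusion.map ((reindex p jR).map η),
        isHomLift_comp (Category.comp_id _) hb' (map_isHomLift_id _), ?_, ?_⟩
    · rw [Category.assoc, map_reindex_map_comp_cartMap, ← Category.assoc, ht₁c, Category.assoc]
    · have := congrArg fiberInclusion.map (adj.counit.naturality ψ')
      rw [CategoryTheory.Functor.map_comp, CategoryTheory.Functor.map_comp] at this
      refine (Category.assoc _ _ _).trans ((congrArg (t₁ ≫ ·) this).trans ?_)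
      rw [← ht₁e]
      exact (Category.assoc _ _ _).symm
    · rw [Category.assoc, map_reindex_map_comp_cartMap, ← Category.assoc, hb'e, Category.assoc]
    · rw [Category.assoc, ← CategoryTheory.Functor.map_comp, hη]
      refine IsStronglyCartesian.hom_ext hc₂
        (isHomLift_comp (Category.comp_id _) hb' (map_isHomLift_id _)) hm'ψ ?_
      rw [Category.assoc, hd, ← Category.assoc, hb'e, Category.assoc, hw'e, ← haw, ← em, ← hm'e]
      simp only [ψ', Category.assoc]
      rw [map_reindex_map_comp_cartMap_assoc]
  have hn : p.IsHomLift σ (sqP'.lift n₁ w' hn₁w') :=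
    isHomLift_of_comp_map π ((sqP'.lift_snd n₁ w' hn₁w').symm ▸ hw')
  obtain ⟨t, ht, hte⟩ := IsStronglyCartesian.exists_lift
    (cartMap_isCartesian jR (pullback (F.map ψ') η)) hτ₁
    (isHomLift_comp rfl (cartMap_isHomLift j' W) hn)
  refine ⟨sqP'.lift n₁ w' hn₁w', ⟨?_, t, hte, ?_⟩, ?_⟩
  · rw [← Category.assoc, sqP'.lift_snd, hw'e]
  · have : t ≫ fiberInclusion.map ((reindex p jR).map P₁) = t₁ := by
      refine IsStronglyCartesian.hom_ext (cartMap_isCartesian jR _)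
        (isHomLift_comp (Category.comp_id _) ht (map_isHomLift_id _)) ht₁ ?_
      rw [Category.assoc, map_reindex_map_comp_cartMap, ← Category.assoc, hte, Category.assoc,
        sqP'.lift_fst, ht₁c]
    simp only [ev]
    rw [CategoryTheory.Functor.map_comp, Category.assoc, ← Category.assoc t, this]
    exact (Category.assoc _ _ _).symm.trans ((congrArg (· ≫ cartMap ev₀ Z) ht₁e).trans hm'e)
  · rintro n' ⟨hn'r, t', ht'e, ht'm⟩
    -- Uniqueness in the base first identifies `σ'` with `σ` and `τ'` with `τ`; only then are the
    -- two components over `R` comparable.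
    obtain ⟨σ', hσ'⟩ := exists_isHomLift_fiber n'
    obtain ⟨τ', hτ'⟩ := exists_isHomLift_fiber t'
    have h₁ : σ' ≫ r₀ = h := isHomLift_unique (isHomLift_comp rfl hσ' hr) (hn'r ▸ hw)
    have h₂ : τ' ≫ jR = j' ≫ σ' := isHomLift_unique
      (isHomLift_comp rfl hτ' (cartMap_isHomLift jR _))
      (ht'e ▸ isHomLift_comp rfl (cartMap_isHomLift j' W) hσ')
    have h₃ : τ' ≫ ev₀ = m₀ := isHomLift_unique (isHomLift_comp rfl hτ' (isHomLift_comp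
      (Category.id_comp _) (map_isHomLift_id _) (cartMap_isHomLift ev₀ Z))) (ht'm ▸ hm)
    obtain rfl : σ' = σ := huσ σ' ⟨h₁, τ', h₂, h₃⟩
    obtain rfl : τ' = τ := H₀.isPullback.hom_ext
      (by rw [hτ₃, ← H₀.ev_comp, ← Category.assoc, h₃, hm₀]) (by rw [h₂, hτ₁])
    apply sqP'.hom_ext
    · rw [sqP'.lift_fst]
      refine hu₁ _ ⟨isHomLift_comp (Category.comp_id _) hσ' (map_isHomLift_id _),
        t' ≫ fiberInclusion.map ((reindex p jR).map P₁),
        isHomLift_comp (Category.comp_id _) hτ' (map_isHomLift_id _), ?_, ?_⟩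
      · rw [Category.assoc, map_reindex_map_comp_cartMap, ← Category.assoc, ht'e, Category.assoc]
      · refine IsStronglyCartesian.hom_ext (cartMap_isCartesian ev₀ Z)
          (isHomLift_comp (Category.comp_id _) (isHomLift_comp (Category.comp_id _) hτ'
            (map_isHomLift_id _)) (map_isHomLift_id _)) hm' ?_
        rw [hm'e, ← ht'm]
        simp only [ev, CategoryTheory.Functor.map_comp, Category.assoc]
    · rw [sqP'.lift_snd]
      refine IsStronglyCartesian.hom_ext (cartMap_isCartesian r₀ X)
        (isHomLift_comp (Category.comp_id _) hσ' (map_isHomLift_id _)) hw' ?_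
      rw [hw'e, Category.assoc, hn'r]

/-- The glued display map category has `Π`-types. -/
lemma gluedMaps_hasPiTypes [IsDisplayMapClass D] (hℰ : IsFibredDisplayMapClass p ℰ)
    (hS : HasSigmaTypes D) (hD : HasPiTypes D) (hp : HasProductsAlong p D)
    (hcl : ClosedUnderProductsAlong p D ℰ)
    (hq : ∀ ⦃I : B⦄ ⦃Z Y X : p.Fiber I⦄ (ψ : Z ⟶ Y) (φ : Y ⟶ X), ℰ I ψ → ℰ I φ →
      ∃ (D' : MorphismProperty B) (ℰ' : ∀ I : B, MorphismProperty (p.Fiber I))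
        (Φ : QuasifibredPi p D' ℰ' ψ φ), D Φ.q ∧ ℰ Φ.Q Φ.π) :
    HasPiTypes (gluedMaps p D ℰ) := by
  have hG := gluedMaps_isDisplayMapClass (D := D) hℰ
  refine HasPiTypes.of_exists_isPi fun {X Y Z} f g hf hg => ?_
  obtain ⟨I, X, rfl⟩ := exists_fiber_obj p X
  obtain ⟨J, Y, rfl⟩ := exists_fiber_obj p Y
  obtain ⟨K, Z, rfl⟩ := exists_fiber_obj p Z
  obtain ⟨j, φ, hj, hφ, rfl⟩ := exists_factorization_of_gluedMaps hℰ hf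
  obtain ⟨k, ψ, hk, hψ, rfl⟩ := exists_factorization_of_gluedMaps hℰ hg
  -- The vertical part of `g` lives over `K`, so `φ` is first reindexed along `k`. The resulting
  -- product lies over `Φ.q ≫ k`, which is where `Σ`-types of the base enter.
  obtain ⟨D', ℰ', Φ, hΦ₁, hΦ₂⟩ := hq ψ ((reindex p k).map φ) hψ (hℰ.map_mem k φ hφ)
  obtain ⟨S₁, k₁, l₁, ev₁, H₁⟩ := Φ.exists_isPi hℰ hφ
  -- the first product is a glued map
  have hr₁ : gluedMaps p D ℰ (fiberInclusion.map Φ.π ≫ cartMap Φ.q _ ≫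
      cartMap k ((reindex p j).obj X)) :=
    (gluedMaps_iff hℰ (isStronglyCartesian_comp rfl (cartMap_isCartesian Φ.q _)
      (cartMap_isCartesian k _)) rfl).2 ⟨hS.comp_mem _ _ hΦ₁ hk, hΦ₂⟩
  obtain ⟨q, π, hq', hπ, e⟩ := exists_factorization_of_gluedMaps hℰ hr₁
  obtain ⟨P, S₂, r₂, k₂, l₂, ev₂, hr₂, H₂⟩ := exists_isPi_cartMap hℰ hD hp hcl hj hq' hπ
  rw [e] at H₂
  have hf₁ : ∀ {W : E} (w : W ⟶ _), HasPullback (fiberInclusion.map φ) w := fun w =>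
    MorphismProperty.HasPullbacks.hasPullback w (gluedMaps_map (D := D) hℰ hφ)
  have hf₂ : ∀ {W : E} (w : W ⟶ _), HasPullback (cartMap j X) w := fun w =>
    MorphismProperty.HasPullbacks.hasPullback w
      (gluedMaps_of_isStronglyCartesian (D := D) hℰ hj (cartMap_isCartesian j X))
  have hk₁ : gluedMaps p D ℰ k₁ :=
    MorphismProperty.of_isPullback H₁.isPullback (gluedMaps_map (D := D) hℰ hφ)
  have := MorphismProperty.HasPullbacks.hasPullback ev₂ hk₁
  exact ⟨_, _, _, _, _, _, hr₂, H₁.comp H₂ (IsPullback.of_hasPullback k₁ ev₂) hf₁ hf₂⟩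

end

/-! ### The glued universe -/

section

variable {B : Type u₁} [Category.{v₁} B] {E : Type u₂} [Category.{v₂} E]
variable {p : E ⥤ B} [p.IsFibered] {D : MorphismProperty B}
  {ℰ : ∀ I : B, MorphismProperty (p.Fiber I)}

/-- There is a map of `E` whose pullbacks are the maps lying over a `u`-small map with `v`-small
vertical component. -/
lemma exists_smallMaps_eq_gluedMaps [IsDisplayMapClass D] (hℰ : IsFibredDisplayMapClass p ℰ)
    (hwr : WellRooted D) (hD : HasPiTypes D) (hp : HasProductsAlong p D)
    {U' U : B} {u : U' ⟶ U} (hu : IsUniverse D u) {Ω : B} {V' V : p.Fiber Ω} {v : V' ⟶ V}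
    (hv : IsQuasifibredUniverse ℰ v) :
    ∃ (W' W : E) (w : W' ⟶ W), smallMaps w = gluedMaps p (smallMaps u) (fibreSmallMaps v) := by
  have hcu := hu.isDisplayMapClass_smallMaps
  have hℰv := hv.isFibredDisplayMapClass hℰ
  -- the base of the universe classifies small maps together with a map from their domain to `Ω`
  obtain ⟨O, o, e, he, hO⟩ : ∃ (O : B) (o : O ⟶ Ω) (e : O ⟶ U'), D e ∧
      ∀ {J : B} (g : J ⟶ Ω) (a : J ⟶ U'), ∃ m : J ⟶ O, m ≫ o = g ∧ m ≫ e = a := by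
    obtain ⟨T, hT, hTD⟩ := hwr
    have := MorphismProperty.HasPullbacks.hasPullback (hT.from U') (hTD Ω)
    have sq := IsPullback.of_hasPullback (hT.from Ω) (hT.from U')
    exact ⟨_, _, _, MorphismProperty.of_isPullback sq (hTD Ω), fun g a =>
      ⟨sq.lift g a (hT.hom_ext _ _), sq.lift_fst _ _ _, sq.lift_snd _ _ _⟩⟩
  -- A map into `R` names a pullback of `u` together with a map from its domain to `Ω`; `k` with `ev
  -- ≫ o` is the generic such pair.
  obtain ⟨R, S, r, k, l, ev, -, H⟩ := hD.exists_isPi hu.mem he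
  have hk : smallMaps u k := ⟨_, _, H.isPullback⟩
  have hkD : D k := MorphismProperty.of_isPullback H.isPullback hu.mem
  have := hp.isLeftAdjoint k hkD
  let F := (reindex p k).rightAdjoint
  let adj : reindex p k ⊣ F := Adjunction.ofIsLeftAdjoint _
  let N := (reindex p (ev ≫ o)).obj V
  let ε : (reindex p k).obj (F.obj N) ⟶ N := adj.counit.app N
  have hv' : ℰ S ((reindex p (ev ≫ o)).map v) := hℰ.map_mem _ v hv.mem
  have hcS := hℰ.isDisplayMapClass S
  have := MorphismProperty.HasPullbacks.hasPullback ε hv'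
  have sqε := IsPullback.of_hasPullback ((reindex p (ev ≫ o)).map v) ε
  set ω := pullback.snd ((reindex p (ev ≫ o)).map v) ε
  have hw : gluedMaps p (smallMaps u) (fibreSmallMaps v)
      (fiberInclusion.map ω ≫ cartMap k (F.obj N)) :=
    (gluedMaps_iff hℰv (cartMap_isCartesian k _) rfl).2 ⟨hk, _, _, _, sqε⟩
  have hG := gluedMaps_isDisplayMapClass (D := smallMaps u) hℰv
  -- One inclusion is stability of the glued class under base change, since the constructed map
  -- belongs to it.
  refine ⟨_, _, fiberInclusion.map ω ≫ cartMap k (F.obj N), le_antisymm (smallMaps_le hw) ?_⟩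
  intro X A f hf
  obtain ⟨J, X, rfl⟩ := exists_fiber_obj p X
  obtain ⟨I, A, rfl⟩ := exists_fiber_obj p A
  obtain ⟨h, φ, ⟨a, b, sqh⟩, ⟨g, x₀, y₀, sqφ⟩, rfl⟩ := exists_factorization_of_gluedMaps hℰv hf
  -- The pair `(h, g)` is named by `n`: then `h` is the pullback of `k` along `n`, and `g` is
  -- recovered as `τ ≫ ev ≫ o`.
  obtain ⟨m, rfl, hma⟩ := hO g a
  obtain ⟨n, ⟨hn, τ, hτ₁, hτ₂⟩, -⟩ := H.existsUnique sqh hma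
  have sqτ : IsPullback τ h k n :=
    IsPullback.of_right (by rw [hn, ← H.ev_comp, ← Category.assoc, hτ₂, hma]; exact sqh) hτ₁
      H.isPullback
  obtain ⟨y, hy, hye⟩ := IsStronglyCartesian.exists_lift (cartMap_isCartesian (ev ≫ o) V)
    (show τ ≫ ev ≫ o = m ≫ o by rw [← Category.assoc, hτ₂])
    (isHomLift_comp (Category.id_comp _) (map_isHomLift_id y₀) (cartMap_isHomLift (m ≫ o) V))
  -- The map `y₀`, read as a map into `N` over `τ`, transposes to `n₁` over `n`. As `t` followed by
  -- the counit gives it back, `f` is the pullback along `n₁`.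
  obtain ⟨n₁, ⟨hn₁, t, ht, htc, hte⟩, -⟩ :=
    hp.existsUnique hkD adj N sqτ (cartMap_isCartesian h A) hy
  have sqR := (hℰ.isPullback_map hv' sqε).paste_horiz (isPullback_reindex_map (ev ≫ o) v)
  have sqL := (hℰ.isPullback_map (hℰ.map_mem _ v hv.mem) sqφ).paste_horiz
    (isPullback_reindex_map (m ≫ o) v)
  have htε : t ≫ fiberInclusion.map ε ≫ cartMap (ev ≫ o) V =
      fiberInclusion.map y₀ ≫ cartMap (m ≫ o) V :=
    (Category.assoc _ _ _).symm.trans ((congrArg (· ≫ cartMap (ev ≫ o) V) hte).trans hye)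
  have hcomm := sqL.w
  rw [← htε, ← Category.assoc (fiberInclusion.map φ)] at hcomm
  have sqM : IsPullback (sqR.lift _ _ hcomm) (fiberInclusion.map φ) (fiberInclusion.map ω) t :=
    IsPullback.of_right (by rw [sqR.lift_fst, htε]; exact sqL) (sqR.lift_snd _ _ hcomm) sqR
  exact ⟨_, _, sqM.paste_vert (isPullback_of_isStronglyCartesian sqτ ht (cartMap_isCartesian h A)
    (cartMap_isCartesian k (F.obj N)) hn₁ htc)⟩

end

/-! ### Left maps without slices -/

section

variable {C : Type u₁} [Category.{v₁} C] {D : MorphismProperty C}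

/-- A map has the left lifting property against display maps as soon as every display map over its
codomain through which it factors has a compatible section. -/
lemma llp_of_exists_section [D.HasPullbacks] [D.IsStableUnderBaseChange] {A X : C} {m : A ⟶ X}
    (h : ∀ {Y : C} (g : Y ⟶ X) (s : A ⟶ Y), D g → s ≫ g = m → ∃ d : X ⟶ Y, m ≫ d = s ∧ d ≫ g = 𝟙 X) :
    D.llp m := by
  intro Y Z g hg
  refine ⟨fun {a b} sq => ?_⟩
  have := MorphismProperty.HasPullbacks.hasPullback b hg
  have sq' := IsPullback.of_hasPullback g b
  obtain ⟨d, hd₁, hd₂⟩ := h _ (sq'.lift a m sq.w) (MorphismProperty.of_isPullback sq' hg)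
    (sq'.lift_snd _ _ _)
  refine ⟨⟨⟨d ≫ pullback.fst g b, ?_, ?_⟩⟩⟩
  · rw [← Category.assoc, hd₁, sq'.lift_fst]
  · rw [Category.assoc, sq'.w, ← Category.assoc, hd₂, Category.id_comp]

lemma leftClass_of_llp {I : C} {A X : DisplaySlice D I} {m : A ⟶ X} (h : D.llp m.hom.left) :
    leftClass D I m := by
  intro Y Z g hg
  refine ⟨fun {a b} sq => ?_⟩
  have := h g.hom.left hg
  have sq' : CommSq a.hom.left m.hom.left g.hom.left b.hom.left :=
    ⟨congrArg (fun k => k.hom.left) sq.w⟩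
  have hl : sq'.lift ≫ Y.obj.hom = X.obj.hom := by
    rw [← Over.w g.hom, ← Category.assoc, sq'.fac_right, Over.w b.hom]
  refine ⟨⟨⟨ObjectProperty.homMk (Over.homMk sq'.lift hl), ?_, ?_⟩⟩⟩
  · apply ObjectProperty.hom_ext
    apply Over.OverMorphism.ext
    exact sq'.fac_left
  · apply ObjectProperty.hom_ext
    apply Over.OverMorphism.ext
    exact sq'.fac_right

/-- By `Σ`-types every display map into `X` is a display map of `D / I`, so lifting in the slice
already provides the sections that suffice by `llp_of_exists_section`. With `leftClass_of_llp`,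
being a left map does not depend on the slice. -/
lemma llp_of_leftClass [D.HasPullbacks] [D.IsStableUnderBaseChange] (hD : HasSigmaTypes D) {I : C}
    {A X : DisplaySlice D I} {m : A ⟶ X} (h : leftClass D I m) : D.llp m.hom.left := by
  refine llp_of_exists_section fun {Y} g s hg hs => ?_
  let Y' : DisplaySlice D I := ⟨Over.mk (g ≫ X.obj.hom), hD.comp_mem _ _ hg X.property⟩
  let g' : Y' ⟶ X := ObjectProperty.homMk (Over.homMk g rfl)
  have hs' : s ≫ g ≫ X.obj.hom = A.obj.hom := by
    rw [← Category.assoc, hs, Over.w m.hom]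
  let s' : A ⟶ Y' := ObjectProperty.homMk (Over.homMk s hs')
  have := h g' hg
  have sq : CommSq s' m g' (𝟙 X) := ⟨by
    apply ObjectProperty.hom_ext
    apply Over.OverMorphism.ext
    exact hs.trans (Category.comp_id _).symm⟩
  exact ⟨sq.lift.hom.left, congrArg (fun k => k.hom.left) sq.fac_left,
    congrArg (fun k => k.hom.left) sq.fac_right⟩

lemma ClosedUnderIdentityTypes.exists_factorization {D' : MorphismProperty C}
    [D.HasPullbacks] [D.IsStableUnderBaseChange] (hD : HasSigmaTypes D) (hD' : D' ≤ D)
    (h : ClosedUnderIdentityTypes D D') {X Y I : C} (k : X ⟶ Y) (y : Y ⟶ I)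
    (hx : D' (k ≫ y)) (hy : D' y) :
    ∃ (K : C) (i : X ⟶ K) (f : K ⟶ Y), D.llp i ∧ D' f ∧ i ≫ f = k := by
  let X' : DisplaySlice D I := ⟨Over.mk (k ≫ y), hD' _ hx⟩
  let Y' : DisplaySlice D I := ⟨Over.mk y, hD' _ hy⟩
  let k' : X' ⟶ Y' := ObjectProperty.homMk (Over.homMk k rfl)
  obtain ⟨K, i, f, -, hi, hf, e⟩ := h k' hx hy
  exact ⟨K.obj.left, i.hom.left, f.hom.left, llp_of_leftClass hD hi, hf,
    congrArg (fun k => k.hom.left) e⟩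

/-- `Σ`-types for `D'` put the middle object back into `D' / I`, so it suffices to factor in `C`. -/
lemma ClosedUnderIdentityTypes.of_exists_factorization {D' : MorphismProperty C}
    (hD' : HasSigmaTypes D') (hle : D' ≤ D)
    (h : ∀ {X Y I : C} (k : X ⟶ Y) (y : Y ⟶ I), D' (k ≫ y) → D' y →
      ∃ (K : C) (i : X ⟶ K) (f : K ⟶ Y), D.llp i ∧ D' f ∧ i ≫ f = k) :
    ClosedUnderIdentityTypes D D' := by
  intro I X Y k hX hY
  obtain ⟨K, i, f, hi, hf, e⟩ := h k.hom.left Y.obj.hom (by rwa [Over.w k.hom]) hY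
  have hK : D' (f ≫ Y.obj.hom) := hD'.comp_mem _ _ hf hY
  let K' : DisplaySlice D I := ⟨Over.mk (f ≫ Y.obj.hom), hle _ hK⟩
  let f' : K' ⟶ Y := ObjectProperty.homMk (Over.homMk f rfl)
  have hi' : i ≫ f ≫ Y.obj.hom = X.obj.hom := by rw [← Category.assoc, e, Over.w k.hom]
  let i' : X ⟶ K' := ObjectProperty.homMk (Over.homMk i hi')
  refine ⟨K', i', f', hK, leftClass_of_llp hi, hf, ?_⟩
  apply ObjectProperty.hom_ext
  apply Over.OverMorphism.ext
  exact e

end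

/-! ### Left maps and identity types of the glued category -/

section

variable {B : Type u₁} [Category.{v₁} B] {E : Type u₂} [Category.{v₂} E]
variable {p : E ⥤ B} [p.IsFibered] {D : MorphismProperty B}
  {ℰ : ∀ I : B, MorphismProperty (p.Fiber I)}

/-- Reindexing the vertical component of a map of `E`. -/
lemma exists_reindex_vertical (hℰ : IsFibredDisplayMapClass p ℰ) {J K L : B} {X : p.Fiber K}
    {A : p.Fiber J} {A' : p.Fiber L} {g₀ : K ⟶ J} {ψ : X ⟶ (reindex p g₀).obj A} (hψ : ℰ K ψ)
    (s : L ⟶ K) {t : L ⟶ J} (e : s ≫ g₀ = t) {c : fiberInclusion.obj A' ⟶ fiberInclusion.obj A}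
    (hc : p.IsStronglyCartesian t c) :
    ∃ ξ : (reindex p s).obj X ⟶ A', ℰ L ξ ∧
      fiberInclusion.map ξ ≫ c = cartMap s X ≫ fiberInclusion.map ψ ≫ cartMap g₀ A := by
  have := hℰ.respectsIso L
  have hc' : p.IsStronglyCartesian t (cartMap s ((reindex p g₀).obj A) ≫ cartMap g₀ A) :=
    isStronglyCartesian_comp e (cartMap_isCartesian s _) (cartMap_isCartesian g₀ A)
  obtain ⟨κ, hκ⟩ := exists_vertical hc hc'.toIsHomLift
  have := isIso_of_isStronglyCartesian hc hc' hκ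
  refine ⟨(reindex p s).map ψ ≫ κ,
    ((ℰ L).cancel_right_of_respectsIso _ _).2 (hℰ.map_mem s ψ hψ), ?_⟩
  rw [CategoryTheory.Functor.map_comp, Category.assoc, hκ, map_reindex_map_comp_cartMap_assoc]

/-- Under the left map condition, cartesian maps over left maps are left maps. -/
lemma cartMap_llp_gluedMaps [IsDisplayMapClass D] (hℰ : IsFibredDisplayMapClass p ℰ)
    (hl : LeftMapCondition p D ℰ) {I J : B} {m : I ⟶ J} (hm : D.llp m) (X : p.Fiber J) :
    (gluedMaps p D ℰ).llp (cartMap m X) := by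
  have hG := gluedMaps_isDisplayMapClass (D := D) hℰ
  refine llp_of_exists_section fun {Y} g s hg hs => ?_
  obtain ⟨K, Y, rfl⟩ := exists_fiber_obj p Y
  obtain ⟨g₀, ψ, hg₀, hψ, rfl⟩ := exists_factorization_of_gluedMaps hℰ hg
  obtain ⟨s₀, hs₀⟩ := exists_isHomLift_fiber s
  have hsg : s₀ ≫ g₀ = m := isHomLift_unique (isHomLift_comp rfl hs₀
    (isHomLift_comp (Category.id_comp _) (map_isHomLift_id ψ) (cartMap_isHomLift g₀ X)))
    (hs ▸ cartMap_isHomLift m X)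
  -- Lifting in the base gives a section of `g₀` extending `s₀`. Reindexing `ψ` along it yields a
  -- display map `ρ` into `X`, and `s` becomes a section of `m^* ρ`.
  have := hm g₀ hg₀
  have sq : CommSq s₀ m g₀ (𝟙 J) := ⟨by rw [hsg, Category.comp_id]⟩
  obtain ⟨ρ, hρ, eρ⟩ := exists_reindex_vertical hℰ hψ sq.lift sq.fac_right
    (isStronglyCartesian_id X)
  rw [Category.comp_id] at eρ
  obtain ⟨s', hs', es'⟩ :=
    IsStronglyCartesian.exists_lift (cartMap_isCartesian sq.lift Y) sq.fac_left hs₀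
  obtain ⟨s'', rfl⟩ := exists_vertical (cartMap_isCartesian m _) hs'
  have hw : s'' ≫ (reindex p m).map ρ = 𝟙 _ := by
    apply vertical_ext (cartMap_isCartesian m X)
    rw [CategoryTheory.Functor.map_comp, Category.assoc, map_reindex_map_comp_cartMap, eρ,
      ← Category.assoc, ← Category.assoc, es', hs, CategoryTheory.Functor.map_id, Category.id_comp]
  have hcX := hℰ.isDisplayMapClass J
  -- A section of `m^* ρ` is a map from the reindexed identity in the slice, so fullness lifts it to
  -- a section of `ρ`.
  let k : (Over.post (X := X) (reindex p m)).obj (Over.mk (𝟙 X)) ⟶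
      (Over.post (X := X) (reindex p m)).obj (Over.mk ρ) :=
    Over.homMk s'' (hw.trans (CategoryTheory.Functor.map_id _ _).symm)
  obtain ⟨k₀, hk₀⟩ := hl m hm X (Over.mk (𝟙 X)) (Over.mk ρ) ((ℰ J).id_mem X) hρ k
  obtain ⟨k₁, hk₁, hk₂⟩ : ∃ k₁ : X ⟶ (reindex p sq.lift).obj Y,
      (reindex p m).map k₁ = s'' ∧ k₁ ≫ ρ = 𝟙 X :=
    ⟨k₀.left, congrArg CommaMorphism.left hk₀, Over.w k₀⟩
  refine ⟨fiberInclusion.map k₁ ≫ cartMap sq.lift Y, ?_, ?_⟩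
  · rw [← es', ← hk₁, map_reindex_map_comp_cartMap, Category.assoc]
  · rw [Category.assoc, ← eρ, ← CategoryTheory.Functor.map_comp, hk₂,
      CategoryTheory.Functor.map_id]

/-- Vertical left maps are left maps of the glued display map category. -/
lemma map_llp_gluedMaps [IsDisplayMapClass D] (hℰ : IsFibredDisplayMapClass p ℰ) {I : B}
    {X Y : p.Fiber I} {l : X ⟶ Y} (hl : (ℰ I).llp l) :
    (gluedMaps p D ℰ).llp (fiberInclusion.map l) := by
  have hG := gluedMaps_isDisplayMapClass (D := D) hℰ
  refine llp_of_exists_section fun {Z} g s hg hs => ?_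
  obtain ⟨K, Z, rfl⟩ := exists_fiber_obj p Z
  obtain ⟨g₀, ψ, hg₀, hψ, rfl⟩ := exists_factorization_of_gluedMaps hℰ hg
  obtain ⟨s₀, hs₀⟩ := exists_isHomLift_fiber s
  have hsg : s₀ ≫ g₀ = 𝟙 I := isHomLift_unique (isHomLift_comp rfl hs₀
    (isHomLift_comp (Category.id_comp _) (map_isHomLift_id ψ) (cartMap_isHomLift g₀ Y)))
    (hs ▸ map_isHomLift_id l)
  -- The map `l` is vertical, so `s₀` is already a section of `g₀` and only a lifting in the fibre
  -- remains.
  obtain ⟨ρ, hρ, eρ⟩ := exists_reindex_vertical hℰ hψ s₀ hsg (isStronglyCartesian_id Y)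
  rw [Category.comp_id] at eρ
  obtain ⟨s', rfl⟩ := exists_vertical (cartMap_isCartesian s₀ Z) hs₀
  have sq : CommSq s' l ρ (𝟙 Y) := ⟨by
    apply Fiber.hom_ext
    rw [CategoryTheory.Functor.map_comp, eρ, ← Category.assoc, hs, Category.comp_id]⟩
  have := hl ρ hρ
  refine ⟨fiberInclusion.map sq.lift ≫ cartMap s₀ Z, ?_, ?_⟩
  · rw [← Category.assoc, ← CategoryTheory.Functor.map_comp, sq.fac_left]
  · rw [Category.assoc, ← eρ, ← CategoryTheory.Functor.map_comp, sq.fac_right,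
      CategoryTheory.Functor.map_id]

/-- Closure of glued classes under identity types. -/
lemma gluedMaps_closedUnderIdentityTypes {D' : MorphismProperty B}
    {ℰ' : ∀ I : B, MorphismProperty (p.Fiber I)} [IsDisplayMapClass D]
    (hℰ : IsFibredDisplayMapClass p ℰ) (hℰ' : IsFibredDisplayMapClass p ℰ') (hD' : D' ≤ D)
    (hle : ∀ I, ℰ' I ≤ ℰ I) (hS : HasSigmaTypes D) (hS' : HasSigmaTypes D')
    (hSℰ : ∀ I, HasSigmaTypes (ℰ I)) (hSℰ' : ∀ I, HasSigmaTypes (ℰ' I))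
    (hl : LeftMapCondition p D ℰ) (hI : ClosedUnderIdentityTypes D D')
    (hIℰ : ∀ I, ClosedUnderIdentityTypes (ℰ I) (ℰ' I)) :
    ClosedUnderIdentityTypes (gluedMaps p D ℰ) (gluedMaps p D' ℰ') := by
  refine ClosedUnderIdentityTypes.of_exists_factorization (gluedMaps_hasSigmaTypes hℰ' hS' hSℰ')
    (fun X Y f hf => ⟨hD' _ hf.1, hle _ _ hf.2⟩) fun {X Y A} k y hx hy => ?_
  obtain ⟨X₀, X, rfl⟩ := exists_fiber_obj p X
  obtain ⟨Y₀, Y, rfl⟩ := exists_fiber_obj p Y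
  obtain ⟨A₀, A, rfl⟩ := exists_fiber_obj p A
  obtain ⟨x₀, φ, hx₀, hφ, ex⟩ := exists_factorization_of_gluedMaps hℰ' hx
  obtain ⟨y₀, ψ, hy₀, hψ, ey⟩ := exists_factorization_of_gluedMaps hℰ' hy
  obtain ⟨k₀, hk⟩ := exists_isHomLift_fiber k
  have hkx : k₀ ≫ y₀ = x₀ := isHomLift_unique
    (isHomLift_comp rfl hk (ey ▸ isHomLift_comp (Category.id_comp _) (map_isHomLift_id ψ)
      (cartMap_isHomLift y₀ A)))
    (ex ▸ isHomLift_comp (Category.id_comp _) (map_isHomLift_id φ) (cartMap_isHomLift x₀ A))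
  obtain ⟨K₀, i₀, f₀, hi₀, hf₀, e₀⟩ :=
    hI.exists_factorization hS hD' k₀ y₀ (hkx.symm ▸ hx₀) hy₀
  -- a retraction of `i₀` over `A₀`
  have sq : CommSq (𝟙 X₀) i₀ x₀ (f₀ ≫ y₀) :=
    ⟨by rw [Category.id_comp, ← Category.assoc, e₀, hkx]⟩
  have := hi₀ x₀ (hD' _ hx₀)
  obtain ⟨r, hr₁, hr₂⟩ : ∃ r : K₀ ⟶ X₀, i₀ ≫ r = 𝟙 X₀ ∧ r ≫ x₀ = f₀ ≫ y₀ :=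
    ⟨sq.lift, sq.fac_left, sq.fac_right⟩
  have hcA := cartMap_isCartesian (f₀ ≫ y₀) A
  -- The objects `r^* X` and `f₀^* Y` both become display objects over `(f₀ ≫ y₀)^* A`, as the left
  -- map condition requires.
  obtain ⟨ξ, hξ, eξ⟩ := exists_reindex_vertical hℰ' hφ r hr₂ hcA
  obtain ⟨υ, hυ, eυ⟩ := exists_reindex_vertical hℰ' hψ f₀ rfl hcA
  rw [ex] at eξ
  rw [ey] at eυ
  -- the map `k` as a map over `i₀`, and the induced map `i₀^* r^* X ⟶ i₀^* f₀^* Y`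
  obtain ⟨k', hk', ek'⟩ := IsStronglyCartesian.exists_lift (cartMap_isCartesian f₀ Y) e₀ hk
  have hcX : p.IsStronglyCartesian (𝟙 X₀) (cartMap i₀ ((reindex p r).obj X) ≫ cartMap r X) :=
    isStronglyCartesian_comp hr₁ (cartMap_isCartesian i₀ _) (cartMap_isCartesian r X)
  obtain ⟨κ, hκ⟩ : ∃ κ : (reindex p i₀).obj ((reindex p r).obj X) ⟶
      (reindex p i₀).obj ((reindex p f₀).obj Y), fiberInclusion.map κ ≫ cartMap i₀ _ =
        (cartMap i₀ ((reindex p r).obj X) ≫ cartMap r X) ≫ k' :=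
    exists_vertical (cartMap_isCartesian i₀ _)
      (isHomLift_comp (Category.id_comp _) hcX.toIsHomLift hk')
  have hw : κ ≫ (reindex p i₀).map υ = (reindex p i₀).map ξ := by
    apply vertical_ext (isStronglyCartesian_comp rfl (cartMap_isCartesian i₀ _) hcA)
    rw [CategoryTheory.Functor.map_comp, Category.assoc, map_reindex_map_comp_cartMap_assoc,
      map_reindex_map_comp_cartMap_assoc, eξ, eυ, ← Category.assoc, hκ, Category.assoc,
      ← Category.assoc k', ek', Category.assoc]
  -- Fullness extends `κ` from `X₀` to a vertical map `r^* X ⟶ f₀^* Y` over `K₀`, which can be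
  -- factored in the fibre.
  let κ' : (Over.post (X := (reindex p (f₀ ≫ y₀)).obj A) (reindex p i₀)).obj (Over.mk ξ) ⟶
      (Over.post (X := (reindex p (f₀ ≫ y₀)).obj A) (reindex p i₀)).obj (Over.mk υ) :=
    Over.homMk κ hw
  obtain ⟨κ₀, hκ₀⟩ := hl i₀ hi₀ _ (Over.mk ξ) (Over.mk υ) (hle _ _ hξ) (hle _ _ hυ) κ'
  obtain ⟨κ₁, hκ₁, hκ₁'⟩ : ∃ κ₁ : (reindex p r).obj X ⟶ (reindex p f₀).obj Y,
      (reindex p i₀).map κ₁ = κ ∧ κ₁ ≫ υ = ξ :=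
    ⟨κ₀.left, congrArg CommaMorphism.left hκ₀, Over.w κ₀⟩
  have hcK := hℰ.isDisplayMapClass K₀
  obtain ⟨K, l, f, hl', hf, e⟩ :=
    (hIℰ K₀).exists_factorization (hSℰ K₀) (hle K₀) κ₁ υ (hκ₁'.symm ▸ hξ) hυ
  -- Since `i₀ ≫ r = 𝟙`, the object `i₀^* r^* X` is isomorphic to `X`. The left factor of `k` is
  -- this isomorphism, the cartesian lift of `i₀` and the vertical left map `l`.
  obtain ⟨ε, hε⟩ := exists_vertical hcX (map_isHomLift_id (𝟙 X))
  have hεi := isIso_of_isStronglyCartesian hcX (c' := fiberInclusion.map (𝟙 X))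
    (by rw [CategoryTheory.Functor.map_id]; exact isStronglyCartesian_id X) hε
  refine ⟨fiberInclusion.obj K, (fiberInclusion.map ε ≫ cartMap i₀ _) ≫ fiberInclusion.map l,
    fiberInclusion.map f ≫ cartMap f₀ Y, ?_,
    (gluedMaps_iff hℰ' (cartMap_isCartesian f₀ Y) rfl).2 ⟨hf₀, hf⟩, ?_⟩
  · refine MorphismProperty.comp_mem _ _ _ ?_ (map_llp_gluedMaps hℰ hl')
    exact (MorphismProperty.cancel_left_of_respectsIso _ _ _).2 (cartMap_llp_gluedMaps hℰ hl hi₀ _)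
  · have h₁ : fiberInclusion.map l ≫ fiberInclusion.map f = fiberInclusion.map κ₁ := by
      rw [← CategoryTheory.Functor.map_comp, e]
    have h₂ := congrArg (· ≫ k') hε
    rw [Category.assoc, Category.assoc, ← Category.assoc (fiberInclusion.map l), h₁,
      ← map_reindex_map_comp_cartMap_assoc, hκ₁, ← Category.assoc (fiberInclusion.map κ), hκ]
    have h₃ : fiberInclusion.map ε ≫ (cartMap i₀ ((reindex p r).obj X) ≫ cartMap r X) ≫ k' =
        k' := (Category.assoc _ _ _).symm.trans
      (h₂.trans (by rw [CategoryTheory.Functor.map_id, Category.id_comp]))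
    rw [← Category.assoc, h₃, ek']

end

end Gluing

/-! ### The main theorem -/

open Gluing
theorem mainTheorem5 {B : Type u₁} [Category.{v₁} B] {E : Type u₂}
    [Category.{v₂} E] (p : E ⥤ B) [p.IsFibered]
    -- the base display map category `(B, D)` and the fibred display map category `(p, ℰ)`
    (D : MorphismProperty B) [IsDisplayMapClass D]
    (ℰ : ∀ I : B, MorphismProperty (p.Fiber I)) (hℰ : IsFibredDisplayMapClass p ℰ)
    (D_wellRooted : WellRooted D) (D_pi : HasPiTypes D)
    (p_products : HasProductsAlong p D)
    -- a universe `u` in the base and a quasifibred universe `(Ω, v)`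
    {U' U : B} (u : U' ⟶ U) (hu : IsUniverse D u)
    {Ω : B} {V' V : p.Fiber Ω} (v : V' ⟶ V) (hv : IsQuasifibredUniverse ℰ v) :
    -- existence of the glued universe
    (∃ (W' W : E) (w : W' ⟶ W), IsUniverse (gluedMaps p D ℰ) w ∧
      ∀ ⦃X A : E⦄ (f : X ⟶ A), smallMaps w f ↔
        gluedMaps p D ℰ f ∧ smallMaps u (p.map f) ∧
          fibreSmallMaps v (p.obj X) (verticalPart p f)) ∧
    -- closure of the glued universe under type constructors
    (HasSigmaTypes D → HasIdentityTypes D →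
      (∀ I : B, WellRooted (ℰ I)) → (∀ I : B, HasSigmaTypes (ℰ I)) →
      HasFibrewiseIdentityTypes p ℰ → LeftMapCondition p D ℰ →
      ClosedUnderProductsAlong p D ℰ →
      HasSigmaTypes (smallMaps u) → HasPiTypes (smallMaps u) →
      ClosedUnderIdentityTypes D (smallMaps u) →
      (∀ I : B, HasSigmaTypes (fibreSmallMaps v I)) →
      (∀ I : B, ClosedUnderIdentityTypes (ℰ I) (fibreSmallMaps v I)) →
      ClosedUnderProductsAlong p (smallMaps u) (fibreSmallMaps v) →
      (∀ ⦃I : B⦄ ⦃Z Y X : p.Fiber I⦄ (ψ : Z ⟶ Y) (φ : Y ⟶ X), ℰ I ψ → ℰ I φ →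
        ∃ π : QuasifibredPi p D ℰ ψ φ,
          fibreSmallMaps v I ψ → fibreSmallMaps v I φ →
            smallMaps u π.q ∧ fibreSmallMaps v π.Q π.π) →
      ∀ (W' W : E) (w : W' ⟶ W), IsUniverse (gluedMaps p D ℰ) w →
        (∀ ⦃X A : E⦄ (f : X ⟶ A), smallMaps w f ↔
          gluedMaps p D ℰ f ∧ smallMaps u (p.map f) ∧
            fibreSmallMaps v (p.obj X) (verticalPart p f)) →
        HasSigmaTypes (smallMaps w) ∧ HasPiTypes (smallMaps w) ∧
          ClosedUnderIdentityTypes (gluedMaps p D ℰ) (smallMaps w)) := by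
  have hDu := hu.isDisplayMapClass_smallMaps
  have hle : smallMaps u ≤ D := smallMaps_le hu.mem
  have hlev : ∀ I, fibreSmallMaps v I ≤ ℰ I := fibreSmallMaps_le hℰ hv.mem
  have hℰv := hv.isFibredDisplayMapClass hℰ
  have hG := gluedMaps_isDisplayMapClass (D := D) hℰ
  have hG' := gluedMaps_isDisplayMapClass (D := smallMaps u) hℰv
  have hleG : gluedMaps p (smallMaps u) (fibreSmallMaps v) ≤ gluedMaps p D ℰ :=
    fun _ _ _ hf => ⟨hle _ hf.1, hlev _ _ hf.2⟩
  refine ⟨?_, ?_⟩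
  · obtain ⟨W', W, w, hw⟩ := exists_smallMaps_eq_gluedMaps hℰ D_wellRooted D_pi p_products hu hv
    refine ⟨W', W, w, ⟨hG, hleG _ ?_, hw ▸ hG'⟩, fun X A f => ?_⟩
    · rw [← hw]
      exact ⟨_, _, IsPullback.id_horiz w⟩
    · rw [hw]
      exact ⟨fun hf => ⟨hleG _ hf, hf.1, hf.2⟩, fun hf => ⟨hf.2.1, hf.2.2⟩⟩
  · intro hSD _ _ hSℰ _ hleft _ hSu hPu hIu hSv hIv hPv hq W' W w _ hw
    -- All three closure properties depend on `w` only through its class of small maps, so any `w`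
    -- as in the first part may be replaced by this class.
    have hw' : smallMaps w = gluedMaps p (smallMaps u) (fibreSmallMaps v) := by
      apply MorphismProperty.ext
      intro X A f
      rw [hw]
      exact ⟨fun hf => ⟨hf.2.1, hf.2.2⟩, fun hf => ⟨hleG _ hf, hf.1, hf.2⟩⟩
    rw [hw']
    refine ⟨gluedMaps_hasSigmaTypes hℰv hSu hSv,
      gluedMaps_hasPiTypes hℰv hSu hPu (p_products.of_le hle) hPv ?_,
      gluedMaps_closedUnderIdentityTypes hℰ hℰv hle hlev hSD hSu hSℰ hSv hleft hIu hIv⟩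
    intro I Z Y X ψ φ hψ hφ
    obtain ⟨Φ, hΦ⟩ := hq ψ φ (hlev I _ hψ) (hlev I _ hφ)
    -- The product is taken with respect to `D` and `ℰ`; for gluing the small classes it is enough
    -- that its two display maps are small.
    exact ⟨D, ℰ, Φ, hΦ hψ hφ⟩
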